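/- **Setting.** An online control problem has $H$ rounds $h=0,\dots,H-1$, a state set $\mathcal X\subseteq\mathbb R^k$, a nonempty closed convex action set $\mathcal U\subseteq\mathbb R^d$ whose diameter is at most $A$, and a fixed initial state $x_0\in\mathcal X$. In round $h$ a context $y_h$ determines dynamics $f_h:\mathcal X\times\mathcal U\to\mathcal X$, a loss $c_h$ and a risk $r_h$; applying $u_h\in\mathcal U$ at $x_h$ gives $x_{h+1}=f_h(x_h,u_h)$. Assume: $f_h$ is $\sigma_x$-Lipschitz in $x$ and $\sigma_u$-Lipschitz in $u$; $r_h\ge 0$ is $\alpha$-strongly convex and $\beta$-smooth on $\mathbb R^k\times\mathbb R^d$ ($\alpha,\beta>0$); on $\mathcal X\times\mathcal U$, $0\le c_h\le P$ and $|c_h(x,u)-c_h(x',u')|\le L_c(\|x-x'\|+\|u-u'\|)$. A policy $\pi$ chooses $u_h\in\mathcal U$ from $s_h$, i.e. from $x_h$ and the contexts $y_0,\dots,y_h$; $J_H^\pi=\sum_{h<H}c_h(x_h,u_h)$. Expectations are over a context sequence $y$ with an arbitrary law $\mu$. All data are measurable. Let $\pi^\dagger$ be a control prior, with states $x_h^\dagger$,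 actions $u_h^\dagger$, risks $r_h^\dagger=r_h(x_h^\dagger,u_h^\dagger)$ and $R_h^\dagger=\sum_{i\le h}r_i^\dagger$ along its own trajectory. Let $\lambda>0$, $C_2>1$, $C_1=1+\frac1{\sqrt{1+\lambda}}$, and $$q_h=C_1\Big(1+\frac1\lambda\Big)\frac\beta2\sum_{i=0}^{H-h-1}(C_2\sigma_x^2)^i .$$ The safe action set in round $h$, at the state $x_h$ and with $R_{h-1}=\sum_{i<h}r_i(x_i,u_i)$, is $$\mathcal U_{\lambda,h}=\Big\{u\in\mathcal U:\ R_{h-1}+r_h(x_h,u)+q_h\|f_h(x_h,u)-f_h(x_h^\dagger,u_h^\dagger)\|^2\le(1+\lambda)R_h^\dagger\Big\}.$$ For an ML policy $\tilde\pi$, the learning-augmented policy plays $u_h=m(\tilde u_h,\mathcal U_{\lambda,h})$ with $\tilde u_h=\tilde\pi(s_h)$, where $m$ is either a nearest-point projection onto $\mathcal U_{\lambda,h}$, or the linear map with $u_h=\tilde u_h$ if $\tilde u_h\in\mathcal U_{\lambda,h}$ and otherwise $u_h=\rho\tilde u_h+(1-\rho)u_h^\dagger$ for some $\rho\in[0,1]$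 for which the constraint holds with equality. Write $J_{H,\lambda}^{\tilde\pi}$ for its cumulative loss. Let $\Pi$ be a class of ML policies for which the safe actions are measurable functions of $y$ and the resulting safe policies form a pointwise measurable class (a countable subclass is dense for pointwise convergence of sequences of the safe actions). Let $\mathcal D_n$ consist of $n\ge1$ independent context sequences with law $\mu$. A finetuned policy $\tilde\pi_\lambda^{(n)}$ is any minimizer over $\tilde\pi\in\Pi$ of the empirical loss of safe actions $\sum_{y\in\mathcal D_n}J_{H,\lambda}^{\tilde\pi}(y)$; put $J_H^{\pi_\lambda^{(n)}}=J_{H,\lambda}^{\tilde\pi_\lambda^{(n)}}$. Let $N(\epsilon,\Pi_\lambda,\hat L_1^n)$ be the $\epsilon$-covering number of the class $\Pi_\lambda$ of safe policies obtained from $\Pi$ for the empirical distance $$\|\pi-\pi'\|_{\hat L_1^n}=\frac1n\sum_{t=1}^n\sum_{h<H}\|\pi(s_h^{(t)})-\pi'(s_h^{(t)})\|_1$$ between the actions that $\pi$ and $\pi'$ take on the $t$-th sequence of $\mathcal D_n$ (each along its own trajectory; the centers of a cover need not lie in the class). **Theorem.** There is a universal constant $C>0$ such that the following holds in every such setting.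 Let $\pi^*\in\Pi$ be $L_\pi$-Lipschitz in the state (for instance the unconstrained-optimal policy, the minimizer of $\mathbb E[J_H^{\pi}]$ over $\Pi$), let $\delta_h=\|u_h^*-u_h^\dagger\|$, where $u_h^*$ is the action of $\pi^*$ along its own trajectory without safety constraint, and let $$G_h=\frac{2}{\beta A\Big(1+\frac{C_2}{C_2-1}\sigma_u^2\sum_{i=0}^{H-h-1}(C_2\sigma_x^2)^i\Big)}\ \ (G_h=0\text{ if }A=0),$$ $$B=L_c\Big(1+(1+2L_\pi)\sigma_u\sum_{i=0}^{H-1}(\sigma_x+2\sigma_uL_\pi)^i\Big),\qquad K=L_c\Big(1+\sigma_u\sum_{i=0}^{H-1}\sigma_x^i\Big).$$ Then for all $n\ge1$, $\delta\in(0,1)$ and $\epsilon>0$, with probability at least $1-\delta$ over $\mathcal D_n$, every finetuned policy satisfies $$\mathbb E\big[J_H^{\pi_\lambda^{(n)}}\big]\le\mathbb E\big[J_H^{\pi^*}\big]+B\,\mathbb E\Big[\sum_{h=0}^{H-1}\big[\delta_h-(\sqrt{1+\lambda}-1)^2G_hr_h^\dagger\big]^+\Big]+C\Big(HP\sqrt{\frac1n\ln\frac{N(\epsilon,\Pi_\lambda,\hat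 L_1^n)}{\delta}}+K\epsilon\Big).$$ In particular, whenever $K\epsilon\le HP\sqrt{\frac1n\ln\frac{N(\epsilon,\Pi_\lambda,\hat L_1^n)}{\delta}}$, the last term is $O\Big(HP\sqrt{\frac1n\ln\frac{N(\epsilon,\Pi_\lambda,\hat L_1^n)}{\delta}}\Big)$. -/

import Mathlib

open MeasureTheory Filter Topology

/-- The Euclidean space `ℝ^k`. -/
abbrev Euc (k : ℕ) : Type := EuclideanSpace ℝ (Fin k)

/-- The data of a finite-horizon online control problem with contexts in `Y`, states in `ℝ^k`
and actions in `ℝ^d`.  In round `h = 0, …, H - 1` the context `y_h : Y` determines the dynamics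
`f_h = dyn h y_h`, the loss `c_h = cost h y_h` and the risk `r_h = risk h y_h`. -/
structure ControlSystem (Y : Type*) (k d : ℕ) where
  /-- the number `H` of rounds -/
  horizon : ℕ
  /-- the state set -/
  stateSet : Set (Euc k)
  /-- the action set -/
  actionSet : Set (Euc d)
  /-- the initial state -/
  init : Euc k
  dyn : ℕ → Y → Euc k → Euc d → Euc k
  cost : ℕ → Y → Euc k → Euc d → ℝ
  risk : ℕ → Y → Euc k → Euc d → ℝ

/-- An online policy: in round `h` the action is a function of the current state and of the
contexts `y_0, …, y_h` (a policy is free to ignore a part of them, so a policy that observes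
less is a special case). -/
abbrev Policy (Y : Type*) (k d : ℕ) : Type _ :=
  (h : ℕ) → Euc k → (Fin (h + 1) → Y) → Euc d

/-- The contexts `y_0, …, y_h` of a context sequence. -/
def prefixUpTo {Y : Type*} (y : ℕ → Y) (h : ℕ) : Fin (h + 1) → Y := fun i => y i

noncomputable section

namespace ControlSystem

variable {Y : Type*} {k d : ℕ}

/-- The standing assumptions: Lipschitz dynamics (constants `σx`, `σu`); risk functions that are
non-negative, `α`-strongly convex and `β`-smooth in `(x, u)`; losses with values in `[0, P]`
that are `Lc`-Lipschitz in `(x, u)`; a nonempty closed convex action set of size at most `A`;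
measurability of all the data. -/
structure Regular [MeasurableSpace Y] (S : ControlSystem Y k d) (σx σu α β Lc P A : ℝ) :
    Prop where
  σx_nonneg : 0 ≤ σx
  σu_nonneg : 0 ≤ σu
  α_pos : 0 < α
  β_pos : 0 < β
  Lc_nonneg : 0 ≤ Lc
  P_nonneg : 0 ≤ P
  A_nonneg : 0 ≤ A
  init_mem : S.init ∈ S.stateSet
  action_nonempty : S.actionSet.Nonempty
  action_closed : IsClosed S.actionSet
  action_convex : Convex ℝ S.actionSet
  action_size : ∀ u ∈ S.actionSet, ∀ u' ∈ S.actionSet, ‖u - u'‖ ≤ A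
  dyn_mem : ∀ h y, ∀ x ∈ S.stateSet, ∀ u ∈ S.actionSet, S.dyn h y x u ∈ S.stateSet
  dyn_lipschitz_state : ∀ h y, ∀ x ∈ S.stateSet, ∀ x' ∈ S.stateSet, ∀ u ∈ S.actionSet,
    ‖S.dyn h y x u - S.dyn h y x' u‖ ≤ σx * ‖x - x'‖
  dyn_lipschitz_action : ∀ h y, ∀ x ∈ S.stateSet, ∀ u ∈ S.actionSet, ∀ u' ∈ S.actionSet,
    ‖S.dyn h y x u - S.dyn h y x u'‖ ≤ σu * ‖u - u'‖
  risk_nonneg : ∀ h y x u, 0 ≤ S.risk h y x u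
  risk_strongConvex : ∀ h y, StrongConvexOn Set.univ α
    (fun z : WithLp 2 (Euc k × Euc d) => S.risk h y z.fst z.snd)
  risk_differentiable : ∀ h y, Differentiable ℝ
    (fun z : WithLp 2 (Euc k × Euc d) => S.risk h y z.fst z.snd)
  risk_smooth : ∀ h y, ∀ z z' : WithLp 2 (Euc k × Euc d),
    ‖fderiv ℝ (fun z : WithLp 2 (Euc k × Euc d) => S.risk h y z.fst z.snd) z
      - fderiv ℝ (fun z : WithLp 2 (Euc k × Euc d) => S.risk h y z.fst z.snd) z'‖
      ≤ β * ‖z - z'‖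
  cost_nonneg : ∀ h y, ∀ x ∈ S.stateSet, ∀ u ∈ S.actionSet, 0 ≤ S.cost h y x u
  cost_le : ∀ h y, ∀ x ∈ S.stateSet, ∀ u ∈ S.actionSet, S.cost h y x u ≤ P
  cost_lipschitz : ∀ h y, ∀ x ∈ S.stateSet, ∀ u ∈ S.actionSet, ∀ x' ∈ S.stateSet,
    ∀ u' ∈ S.actionSet,
    |S.cost h y x u - S.cost h y x' u'| ≤ Lc * (‖x - x'‖ + ‖u - u'‖)
  measurable_dyn : ∀ h, Measurable (fun p : Y × Euc k × Euc d => S.dyn h p.1 p.2.1 p.2.2)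
  measurable_cost : ∀ h, Measurable (fun p : Y × Euc k × Euc d => S.cost h p.1 p.2.1 p.2.2)
  measurable_risk : ∀ h, Measurable (fun p : Y × Euc k × Euc d => S.risk h p.1 p.2.1 p.2.2)

/-- A measurable policy with values in the action set. -/
def Admissible [MeasurableSpace Y] (S : ControlSystem Y k d) (π : Policy Y k d) : Prop :=
  (∀ h, ∀ x ∈ S.stateSet, ∀ ω, π h x ω ∈ S.actionSet) ∧
    ∀ h, Measurable (fun p : Euc k × (Fin (h + 1) → Y) => π h p.1 p.2)

/-- The policy is `L`-Lipschitz in the state, in every round and for every observed context. -/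
def PolicyLipschitz (S : ControlSystem Y k d) (π : Policy Y k d) (L : ℝ) : Prop :=
  ∀ h, ∀ x ∈ S.stateSet, ∀ x' ∈ S.stateSet, ∀ ω, ‖π h x ω - π h x' ω‖ ≤ L * ‖x - x'‖

/-! ### Running a policy without a safety constraint -/

/-- The state `x_h` when `π` is run on the context sequence `y`. -/
def state (S : ControlSystem Y k d) (π : Policy Y k d) (y : ℕ → Y) : ℕ → Euc k
  | 0 => S.init
  | h + 1 => S.dyn h (y h) (S.state π y h) (π h (S.state π y h) (prefixUpTo y h))

/-- The action `u_h` when `π` is run on the context sequence `y`. -/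
def action (S : ControlSystem Y k d) (π : Policy Y k d) (y : ℕ → Y) (h : ℕ) : Euc d :=
  π h (S.state π y h) (prefixUpTo y h)

/-- The cumulative loss `J_H^π(y)`. -/
def loss (S : ControlSystem Y k d) (π : Policy Y k d) (y : ℕ → Y) : ℝ :=
  ∑ h ∈ Finset.range S.horizon, S.cost h (y h) (S.state π y h) (S.action π y h)

/-- The risk `r_h(x_h, u_h)` in round `h` when `π` is run on `y`. -/
def roundRisk (S : ControlSystem Y k d) (π : Policy Y k d) (y : ℕ → Y) (h : ℕ) : ℝ :=
  S.risk h (y h) (S.state π y h) (S.action π y h)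

/-- The cumulative risk `R_h^π = ∑_{i ≤ h} r_i(x_i, u_i)` when `π` is run on `y`. -/
def cumRisk (S : ControlSystem Y k d) (π : Policy Y k d) (y : ℕ → Y) (h : ℕ) : ℝ :=
  ∑ i ∈ Finset.range (h + 1), S.roundRisk π y i

/-! ### The safe action sets and the learning-augmented policy -/

/-- The reservation weight
`q_h = C₁ (1 + 1/λ) (β/2) ∑_{i=0}^{H-h-1} (C₂ σx²)^i`. -/
def reservationWeight (S : ControlSystem Y k d) (C₁ C₂ lam β σx : ℝ) (h : ℕ) : ℝ :=
  C₁ * (1 + 1 / lam) * (β / 2) * ∑ i ∈ Finset.range (S.horizon - h), (C₂ * σx ^ 2) ^ i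

/-- The excess
`R_{h-1} + r_h(x, u) + q_h ‖f_h(x, u) - f_h(x†_h, u†_h)‖² - (1 + λ) R†_h`
of an action `u` in round `h`, at the state `x` and with accumulated risk `R = R_{h-1}`. -/
def excess (S : ControlSystem Y k d) (lam : ℝ) (q : ℕ → ℝ) (prior : Policy Y k d)
    (y : ℕ → Y) (h : ℕ) (x : Euc k) (R : ℝ) (u : Euc d) : ℝ :=
  R + S.risk h (y h) x u
    + q h * ‖S.dyn h (y h) x u
        - S.dyn h (y h) (S.state prior y h) (S.action prior y h)‖ ^ 2
    - (1 + lam) * S.cumRisk prior y h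

/-- The safe action set `{u ∈ 𝒰 | g u ≤ 0}` for the excess function `g`. -/
def safeSet (S : ControlSystem Y k d) (g : Euc d → ℝ) : Set (Euc d) :=
  {u | u ∈ S.actionSet ∧ g u ≤ 0}

/-- `m g u† ũ` is a nearest point to the ML action `ũ` in the safe action set given by the excess
function `g`, whenever `g` is continuous and the prior action `u†` is safe. -/
def IsProjectionMap (S : ControlSystem Y k d)
    (m : (Euc d → ℝ) → Euc d → Euc d → Euc d) : Prop :=
  ∀ g u' v, ContinuousOn g S.actionSet → u' ∈ S.safeSet g → v ∈ S.actionSet →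
    m g u' v ∈ S.safeSet g ∧ ∀ w ∈ S.safeSet g, ‖v - m g u' v‖ ≤ ‖v - w‖

/-- `m g u† ũ` is the ML action `ũ` if that one is safe, and otherwise it is a combination
`ρ ũ + (1 - ρ) u†` with `ρ ∈ [0, 1]` at which the safety constraint is tight, whenever the excess
function `g` is continuous and the prior action `u†` is safe. -/
def IsCombinationMap (S : ControlSystem Y k d)
    (m : (Euc d → ℝ) → Euc d → Euc d → Euc d) : Prop :=
  ∀ g u' v, ContinuousOn g S.actionSet → u' ∈ S.safeSet g → v ∈ S.actionSet →
    (v ∈ S.safeSet g → m g u' v = v) ∧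
    (v ∉ S.safeSet g → ∃ ρ : ℝ, 0 ≤ ρ ∧ ρ ≤ 1 ∧
      m g u' v = ρ • v + (1 - ρ) • u' ∧ g (m g u' v) = 0)

/-- The pair `(x_h, R_{h-1})` of state and accumulated risk when the learning-augmented policy
with the ML policy `π` is run on the context sequence `y`. -/
def safeRun (S : ControlSystem Y k d) (lam : ℝ) (q : ℕ → ℝ)
    (m : (Euc d → ℝ) → Euc d → Euc d → Euc d) (prior π : Policy Y k d) (y : ℕ → Y) :
    ℕ → Euc k × ℝ
  | 0 => (S.init, 0)
  | h + 1 =>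
    let s := S.safeRun lam q m prior π y h
    let u := m (S.excess lam q prior y h s.1 s.2) (S.action prior y h)
      (π h s.1 (prefixUpTo y h))
    (S.dyn h (y h) s.1 u, s.2 + S.risk h (y h) s.1 u)

/-- The action `u_h = m(π(s_h), U_{λ,h})` of the learning-augmented policy. -/
def safeAction (S : ControlSystem Y k d) (lam : ℝ) (q : ℕ → ℝ)
    (m : (Euc d → ℝ) → Euc d → Euc d → Euc d) (prior π : Policy Y k d) (y : ℕ → Y)
    (h : ℕ) : Euc d :=
  m (S.excess lam q prior y h (S.safeRun lam q m prior π y h).1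
      (S.safeRun lam q m prior π y h).2)
    (S.action prior y h) (π h (S.safeRun lam q m prior π y h).1 (prefixUpTo y h))

/-- The cumulative loss of the learning-augmented policy with the ML policy `π`. -/
def safeLoss (S : ControlSystem Y k d) (lam : ℝ) (q : ℕ → ℝ)
    (m : (Euc d → ℝ) → Euc d → Euc d → Euc d) (prior π : Policy Y k d) (y : ℕ → Y) : ℝ :=
  ∑ h ∈ Finset.range S.horizon,
    S.cost h (y h) (S.safeRun lam q m prior π y h).1 (S.safeAction lam q m prior π y h)

/-- `π` is a result of safety-aware finetuning over the class `Pol` on the data set `D` of `n`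
context sequences: it minimizes the total loss of the safe actions on `D`. -/
def IsFinetuned (S : ControlSystem Y k d) (lam : ℝ) (q : ℕ → ℝ)
    (m : (Euc d → ℝ) → Euc d → Euc d → Euc d) (prior : Policy Y k d)
    (Pol : Set (Policy Y k d)) {n : ℕ} (D : Fin n → ℕ → Y) (π : Policy Y k d) : Prop :=
  π ∈ Pol ∧ ∀ π' ∈ Pol,
    ∑ t, S.safeLoss lam q m prior π (D t) ≤ ∑ t, S.safeLoss lam q m prior π' (D t)

/-! ### The empirical covering number of the safe policy class -/

/-- The empirical `L₁` distance `(1/n) ∑_t ∑_{h < H} ‖a_h^{(t)} - b_h^{(t)}‖₁` of two families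
of actions. -/
def empDist (S : ControlSystem Y k d) {n : ℕ} (a b : Fin n → ℕ → Euc d) : ℝ :=
  (1 / (n : ℝ)) * ∑ t, ∑ h ∈ Finset.range S.horizon, ∑ j, |a t h j - b t h j|

/-- The `ε`-covering number, on the data set `D`, of the class of the safe policies that arise
from the ML policies in `Pol`: the least number of centers such that the action family of every
safe policy on `D` is within empirical `L₁` distance `ε` of a center.  (The centers need not come
from the class.  Finite covers exist as soon as `ε > 0` and the actions are bounded.) -/
def coveringNumber (S : ControlSystem Y k d) (lam : ℝ) (q : ℕ → ℝ)
    (m : (Euc d → ℝ) → Euc d → Euc d → Euc d) (prior : Policy Y k d)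
    (Pol : Set (Policy Y k d)) {n : ℕ} (D : Fin n → ℕ → Y) (ε : ℝ) : ℕ :=
  sInf {N : ℕ | ∃ T : Finset (Fin n → ℕ → Euc d), T.card = N ∧
    ∀ π ∈ Pol, ∃ b ∈ T, S.empDist (fun t h => S.safeAction lam q m prior π (D t) h) b ≤ ε}

/-- The measurability convention for the class: the safe actions are measurable functions of the
context sequence, and the class of safe policies has a countable subclass that is dense for
pointwise convergence of sequences (a pointwise measurable class). -/
def PointwiseMeasurable [MeasurableSpace Y] (S : ControlSystem Y k d) (lam : ℝ) (q : ℕ → ℝ)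
    (m : (Euc d → ℝ) → Euc d → Euc d → Euc d) (prior : Policy Y k d)
    (Pol : Set (Policy Y k d)) : Prop :=
  (∀ π ∈ Pol, ∀ h < S.horizon, Measurable (fun y => S.safeAction lam q m prior π y h)) ∧
  ∃ Pol₀ ⊆ Pol, Pol₀.Countable ∧ ∀ π ∈ Pol, ∃ p : ℕ → Policy Y k d, (∀ i, p i ∈ Pol₀) ∧
    ∀ y, ∀ h < S.horizon, Tendsto (fun i => S.safeAction lam q m prior (p i) y h) atTop
      (𝓝 (S.safeAction lam q m prior π y h))

/-! ### The constants of the bound -/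

/-- `G_h = 2 / (β A (1 + C₂/(C₂-1) σu² ∑_{i=0}^{H-h-1} (C₂ σx²)^i))`; the geometric sum is
`(1 - (C₂ σx²)^{H-h}) / (1 - C₂ σx²)`. -/
def gainG (S : ControlSystem Y k d) (σx σu β A C₂ : ℝ) (h : ℕ) : ℝ :=
  2 / (β * A * (1 + C₂ / (C₂ - 1) * σu ^ 2 *
    ∑ i ∈ Finset.range (S.horizon - h), (C₂ * σx ^ 2) ^ i))

/-- `B = Lc (1 + (1 + 2 Lπ) σu ∑_{i=0}^{H-1} (σx + 2 σu Lπ)^i)`. -/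
def constB (S : ControlSystem Y k d) (σx σu Lc Lπ : ℝ) : ℝ :=
  Lc * (1 + (1 + 2 * Lπ) * σu *
    ∑ i ∈ Finset.range S.horizon, (σx + 2 * σu * Lπ) ^ i)

/-- `K = Lc (1 + σu ∑_{i=0}^{H-1} σx^i)`, the sensitivity of the cumulative loss to the
actions. -/
def constK (S : ControlSystem Y k d) (σx σu Lc : ℝ) : ℝ :=
  Lc * (1 + σu * ∑ i ∈ Finset.range S.horizon, σx ^ i)

end ControlSystem

end

/-!
The excess loss of the finetuned policy splits into a deterministic price of safety, paid by the
comparator `π*`, and a statistical error of the empirical minimization.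

*Price of safety.*  Write `s = √(1 + λ)`.  A non-negative `β`-smooth risk satisfies
`r(z') ≤ (1 + a) r(z) + (1 + 1/a) (β/2) ‖z' - z‖²`; for `a = s - 1` the last coefficient is the
constant `C₁ (1 + 1/λ) β/2` of the reservation weights.  Along a safe run the reservation covers the
distance to the state of the prior (`SafeInvariant`), so that the excess of an action `u` is at most
`κ (‖u - u†‖² - θ²)` with `θ² / A = (s - 1)² G_h r†_h` (`SafeSetup.excess_le`).  Hence the prior
action is always safe, together with a ball of radius `θ` around it, and either safety map moves an action
by at most `[‖ũ - u†‖ - θ]⁺ ≤ [‖ũ - u†‖ - θ²/A]⁺` (`Regular.correction_le`).  A linear recursion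
for the distance of the safe and the unconstrained trajectory of `π*` turns this into the term with
`B` (`SafeSetup.safeLoss_le`).  The same recursion shows that the safe loss is `K`-Lipschitz in the
safe actions.

*Statistical error.*  For the class of the differences `g = ℓ_π - ℓ_{π*}` of safe losses consider
`Ψ(D) = sup_g (n 𝔼 g - ∑_t g(D_t)) - 2 𝔼_σ sup_g ∑_t σ_t g(D_t)`.  Symmetrization gives
`𝔼 Ψ ≤ 0`, and changing one sample changes `Ψ` by at most `6HP`, so McDiarmid's inequality bounds `Ψ` by a multiple
of `HP √(n ln(1/δ))` with probability `1 - δ`.  Since `Ψ` contains the Rademacher average of the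
observed sample, that average may be bounded by Massart's lemma with the covering number of this
sample.  A cover with at most `N` members has at most `N/δ` of them, and `N/δ > 1`; this keeps the
bound valid for `N = 1` and `δ` near `1`.
-/

/-! ### Smooth non-negative functions -/

section Smooth

variable {E : Type*} [NormedAddCommGroup E] [NormedSpace ℝ E] {r : E → ℝ} {β : ℝ}

/-- `Differentiable.continuous` over `ℝ`; on a normed space variable the topological instances are
found at once, which is not so on `WithLp 2 (Euc k × Euc d)`. -/
theorem continuous_of_differentiable_real (hr : Differentiable ℝ r) : Continuous r :=
  hr.continuous

theorem smooth_descent (hr : Differentiable ℝ r)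
    (hs : ∀ z z', ‖fderiv ℝ r z - fderiv ℝ r z'‖ ≤ β * ‖z - z'‖) (z v : E) :
    r (z + v) ≤ r z + fderiv ℝ r z v + β / 2 * ‖v‖ ^ 2 := by
  set ψ : ℝ → ℝ := fun t => r (z + t • v) - t * fderiv ℝ r z v - β / 2 * t ^ 2 * ‖v‖ ^ 2 with hψ
  have hd : ∀ t, HasDerivAt ψ
      (fderiv ℝ r (z + t • v) v - fderiv ℝ r z v - β * t * ‖v‖ ^ 2) t := by
    intro t
    have h1 : HasDerivAt (fun t : ℝ => z + t • v) v t := by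
      simpa using ((hasDerivAt_id t).smul_const v).const_add z
    have h2 := (hr (z + t • v)).hasFDerivAt.comp_hasDerivAt t h1
    have h3 : HasDerivAt (fun t : ℝ => t * fderiv ℝ r z v) (fderiv ℝ r z v) t := by
      simpa using (hasDerivAt_id t).mul_const (fderiv ℝ r z v)
    have h4 : HasDerivAt (fun t : ℝ => β / 2 * t ^ 2 * ‖v‖ ^ 2) (β * t * ‖v‖ ^ 2) t := by
      have := (((hasDerivAt_pow 2 t).const_mul (β / 2)).mul_const (‖v‖ ^ 2))
      refine this.congr_deriv ?_
      push_cast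
      ring
    exact (h2.sub h3).sub h4
  have hanti : AntitoneOn ψ (Set.Icc 0 1) := by
    refine antitoneOn_of_deriv_nonpos (convex_Icc 0 1)
      (fun t _ => (hd t).continuousAt.continuousWithinAt)
      (fun t _ => (hd t).differentiableAt.differentiableWithinAt) fun t ht => ?_
    rw [interior_Icc] at ht
    rw [(hd t).deriv]
    have h1 : fderiv ℝ r (z + t • v) v - fderiv ℝ r z v ≤ β * t * ‖v‖ ^ 2 := by
      calc fderiv ℝ r (z + t • v) v - fderiv ℝ r z v
          = (fderiv ℝ r (z + t • v) - fderiv ℝ r z) v := rfl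
        _ ≤ ‖(fderiv ℝ r (z + t • v) - fderiv ℝ r z) v‖ := le_abs_self _
        _ ≤ ‖fderiv ℝ r (z + t • v) - fderiv ℝ r z‖ * ‖v‖ := ContinuousLinearMap.le_opNorm _ _
        _ ≤ β * ‖z + t • v - z‖ * ‖v‖ := by gcongr; exact hs _ _
        _ = β * t * ‖v‖ ^ 2 := by
          rw [add_sub_cancel_left, norm_smul, Real.norm_eq_abs, abs_of_pos ht.1]
          ring
    linarith
  have h := hanti (Set.left_mem_Icc.2 zero_le_one) (Set.right_mem_Icc.2 zero_le_one) zero_le_one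
  simp only [hψ, one_smul, zero_smul, add_zero] at h
  linarith

/-- A non-negative `β`-smooth function at most multiplies by `1 + a` along a displacement, up to a
quadratic error.  The linear term is absorbed by non-negativity at the point `z - v / a`. -/
theorem smooth_nonneg_le (hr : Differentiable ℝ r) (h0 : ∀ z, 0 ≤ r z)
    (hs : ∀ z z', ‖fderiv ℝ r z - fderiv ℝ r z'‖ ≤ β * ‖z - z'‖) (z z' : E) {a : ℝ} (ha : 0 < a) :
    r z' ≤ (1 + a) * r z + (1 + 1 / a) * (β / 2) * ‖z' - z‖ ^ 2 := by
  have h1 := smooth_descent hr hs z (z' - z)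
  have h2 := smooth_descent hr hs z (-(1 / a) • (z' - z))
  have h3 := h0 (z + -(1 / a) • (z' - z))
  rw [add_sub_cancel] at h1
  rw [map_smul, norm_smul, Real.norm_eq_abs, abs_neg, abs_of_pos (by positivity), smul_eq_mul]
    at h2
  have h4 : fderiv ℝ r z (z' - z) ≤ a * r z + 1 / a * (β / 2) * ‖z' - z‖ ^ 2 := by
    have h5 : 0 ≤ a * (r z + -(1 / a) * fderiv ℝ r z (z' - z)
        + β / 2 * (1 / a * ‖z' - z‖) ^ 2) := mul_nonneg ha.le (h3.trans h2)
    have h6 : a * (r z + -(1 / a) * fderiv ℝ r z (z' - z) + β / 2 * (1 / a * ‖z' - z‖) ^ 2)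
        = a * r z - fderiv ℝ r z (z' - z) + 1 / a * (β / 2) * ‖z' - z‖ ^ 2 := by
      field_simp
      ring
    linarith
  linarith

end Smooth

/-! ### A linear recursion -/

/-- A discrete Grönwall inequality for sums. -/
theorem sum_le_of_linear_recursion {H : ℕ} {e p : ℕ → ℝ} {a b : ℝ} (ha : 0 ≤ a) (hb : 0 ≤ b)
    (hp : ∀ h, 0 ≤ p h) (h0 : e 0 = 0) (hstep : ∀ h < H, e (h + 1) ≤ a * e h + b * p h) :
    ∑ h ∈ Finset.range H, e h
      ≤ b * (∑ i ∈ Finset.range H, a ^ i) * ∑ h ∈ Finset.range H, p h := by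
  induction H with
  | zero => simp
  | succ H ih =>
    have ih := ih fun h hh => hstep h (hh.trans (Nat.lt_succ_self H))
    have hA : (∑ i ∈ Finset.range (H + 1), a ^ i) = a * (∑ i ∈ Finset.range H, a ^ i) + 1 := by
      rw [Finset.sum_range_succ', Finset.mul_sum]
      simp [pow_succ']
    have hA0 : 0 ≤ ∑ i ∈ Finset.range (H + 1), a ^ i := Finset.sum_nonneg fun i _ => pow_nonneg ha i
    calc ∑ h ∈ Finset.range (H + 1), e h
        = ∑ h ∈ Finset.range H, e (h + 1) := by rw [Finset.sum_range_succ', h0, add_zero]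
      _ ≤ ∑ h ∈ Finset.range H, (a * e h + b * p h) :=
          Finset.sum_le_sum fun h hh => hstep h ((Finset.mem_range.1 hh).trans (Nat.lt_succ_self H))
      _ = a * ∑ h ∈ Finset.range H, e h + b * ∑ h ∈ Finset.range H, p h := by
          rw [Finset.sum_add_distrib, Finset.mul_sum, Finset.mul_sum]
      _ ≤ a * (b * (∑ i ∈ Finset.range H, a ^ i) * ∑ h ∈ Finset.range H, p h)
            + b * ∑ h ∈ Finset.range H, p h := by gcongr
      _ = b * (∑ i ∈ Finset.range (H + 1), a ^ i) * ∑ h ∈ Finset.range H, p h := by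
          rw [hA]
          ring
      _ ≤ b * (∑ i ∈ Finset.range (H + 1), a ^ i) * ∑ h ∈ Finset.range (H + 1), p h := by
          rw [Finset.sum_range_succ p]
          gcongr
          linarith [hp H]

namespace ControlSystem

variable {Y : Type*} [MeasurableSpace Y] {k d : ℕ} {S : ControlSystem Y k d}
  {σx σu α β Lc P A : ℝ}

/-! ### Trajectories of a regular system -/

theorem Regular.state_mem (hS : S.Regular σx σu α β Lc P A) {π : Policy Y k d}
    (hπ : S.Admissible π) (y : ℕ → Y) (h : ℕ) : S.state π y h ∈ S.stateSet := by
  induction h with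
  | zero => exact hS.init_mem
  | succ h ih => exact hS.dyn_mem h _ _ ih _ (hπ.1 h _ ih _)

theorem Regular.action_mem (hS : S.Regular σx σu α β Lc P A) {π : Policy Y k d}
    (hπ : S.Admissible π) (y : ℕ → Y) (h : ℕ) : S.action π y h ∈ S.actionSet :=
  hπ.1 h _ (hS.state_mem hπ y h) _

theorem Regular.dyn_sub_le (hS : S.Regular σx σu α β Lc P A) (h : ℕ) (y : Y) {x x' : Euc k}
    (hx : x ∈ S.stateSet) (hx' : x' ∈ S.stateSet) {u u' : Euc d} (hu : u ∈ S.actionSet)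
    (hu' : u' ∈ S.actionSet) :
    ‖S.dyn h y x u - S.dyn h y x' u'‖ ≤ σx * ‖x - x'‖ + σu * ‖u - u'‖ := by
  have h1 := hS.dyn_lipschitz_state h y x hx x' hx' u hu
  have h2 := hS.dyn_lipschitz_action h y x' hx' u hu u' hu'
  have h3 := norm_sub_le_norm_sub_add_norm_sub (S.dyn h y x u) (S.dyn h y x' u) (S.dyn h y x' u')
  linarith

theorem Regular.risk_le (hS : S.Regular σx σu α β Lc P A) (h : ℕ) (y : Y) (x x' : Euc k)
    (u u' : Euc d) {a : ℝ} (ha : 0 < a) :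
    S.risk h y x' u' ≤ (1 + a) * S.risk h y x u
      + (1 + 1 / a) * (β / 2) * (‖x' - x‖ ^ 2 + ‖u' - u‖ ^ 2) := by
  have h1 := smooth_nonneg_le (hS.risk_differentiable h y)
    (fun z => hS.risk_nonneg h y z.fst z.snd) (hS.risk_smooth h y)
    (WithLp.toLp 2 (x, u)) (WithLp.toLp 2 (x', u')) ha
  rw [WithLp.prod_norm_sq_eq_of_L2] at h1
  exact h1

/-- Two trajectories whose actions differ in round `h` by at most `p h` plus a multiple `b` of the
distance of the states have total losses that differ by a multiple of `∑ p h`. -/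
theorem Regular.sum_cost_sub_le (hS : S.Regular σx σu α β Lc P A) {y : ℕ → Y}
    {x x' : ℕ → Euc k} {u u' : ℕ → Euc d} {p : ℕ → ℝ} {b : ℝ} (hb : 0 ≤ b) (hp : ∀ h, 0 ≤ p h)
    (hx : ∀ h < S.horizon, x h ∈ S.stateSet) (hx' : ∀ h < S.horizon, x' h ∈ S.stateSet)
    (hu : ∀ h < S.horizon, u h ∈ S.actionSet) (hu' : ∀ h < S.horizon, u' h ∈ S.actionSet)
    (hxs : ∀ h, x (h + 1) = S.dyn h (y h) (x h) (u h))
    (hxs' : ∀ h, x' (h + 1) = S.dyn h (y h) (x' h) (u' h)) (h0 : x 0 = x' 0)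
    (hup : ∀ h < S.horizon, ‖u h - u' h‖ ≤ p h + b * ‖x h - x' h‖) :
    |∑ h ∈ Finset.range S.horizon, S.cost h (y h) (x h) (u h)
        - ∑ h ∈ Finset.range S.horizon, S.cost h (y h) (x' h) (u' h)|
      ≤ Lc * (1 + (1 + b) * σu * ∑ i ∈ Finset.range S.horizon, (σx + σu * b) ^ i)
        * ∑ h ∈ Finset.range S.horizon, p h := by
  have hσx := hS.σx_nonneg
  have hσu := hS.σu_nonneg
  have hLc := hS.Lc_nonneg
  have hrec := sum_le_of_linear_recursion (H := S.horizon) (e := fun h => ‖x h - x' h‖) (p := p)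
    (a := σx + σu * b) (b := σu) (by positivity) hσu hp (by simp [h0]) fun h hh => by
      have h1 := hS.dyn_sub_le h (y h) (hx h hh) (hx' h hh) (hu h hh) (hu' h hh)
      have h2 := mul_le_mul_of_nonneg_left (hup h hh) hσu
      simp only [hxs, hxs']
      linarith
  rw [← Finset.sum_sub_distrib]
  calc |∑ h ∈ Finset.range S.horizon,
          (S.cost h (y h) (x h) (u h) - S.cost h (y h) (x' h) (u' h))|
      ≤ ∑ h ∈ Finset.range S.horizon,
          |S.cost h (y h) (x h) (u h) - S.cost h (y h) (x' h) (u' h)| :=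
        Finset.abs_sum_le_sum_abs _ _
    _ ≤ ∑ h ∈ Finset.range S.horizon, Lc * ((1 + b) * ‖x h - x' h‖ + p h) := by
        refine Finset.sum_le_sum fun h hh => ?_
        rw [Finset.mem_range] at hh
        refine (hS.cost_lipschitz h (y h) _ (hx h hh) _ (hu h hh) _ (hx' h hh) _
          (hu' h hh)).trans ?_
        have := hup h hh
        refine mul_le_mul_of_nonneg_left ?_ hLc
        linarith
    _ = Lc * ((1 + b) * ∑ h ∈ Finset.range S.horizon, ‖x h - x' h‖
          + ∑ h ∈ Finset.range S.horizon, p h) := by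
        rw [← Finset.mul_sum, Finset.sum_add_distrib, ← Finset.mul_sum]
    _ ≤ Lc * ((1 + b) * (σu * (∑ i ∈ Finset.range S.horizon, (σx + σu * b) ^ i)
          * ∑ h ∈ Finset.range S.horizon, p h) + ∑ h ∈ Finset.range S.horizon, p h) := by
        gcongr
    _ = _ := by ring

/-! ### The correction to a safe action -/

/-- If the excess is at most `κ (‖u - u'‖² - θ²)`, all actions within `θ` of the prior action `u'`
are safe, so neither safety map moves an action further than to this ball.  Since `‖v - u'‖ ≤ A`,
the movement `‖v - u'‖ - θ` is at most `‖v - u'‖ - θ² / A`. -/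
theorem Regular.correction_le (hS : S.Regular σx σu α β Lc P A)
    {m : (Euc d → ℝ) → Euc d → Euc d → Euc d} (hm : S.IsProjectionMap m ∨ S.IsCombinationMap m)
    {g : Euc d → ℝ} (hg : ContinuousOn g S.actionSet) {u' v : Euc d} (hu' : u' ∈ S.actionSet)
    (hv : v ∈ S.actionSet) {κ θ : ℝ} (hκ : 0 < κ) (hθ : 0 ≤ θ)
    (hgκ : ∀ u ∈ S.actionSet, g u ≤ κ * (‖u - u'‖ ^ 2 - θ ^ 2)) :
    m g u' v ∈ S.safeSet g ∧ ‖m g u' v - v‖ ≤ max (‖v - u'‖ - θ ^ 2 / A) 0 := by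
  have hsafe : ∀ w ∈ S.actionSet, ‖w - u'‖ ≤ θ → w ∈ S.safeSet g := by
    intro w hw hwθ
    refine ⟨hw, (hgκ w hw).trans (mul_nonpos_of_nonneg_of_nonpos hκ.le ?_)⟩
    have := pow_le_pow_left₀ (norm_nonneg _) hwθ 2
    linarith
  have hu's : u' ∈ S.safeSet g := hsafe u' hu' (by simpa using hθ)
  have hA : ‖v - u'‖ ≤ A := hS.action_size v hv u' hu'
  rcases le_or_gt ‖v - u'‖ θ with hle | hlt
  · have hvs := hsafe v hv hle
    have hmv : m g u' v = v := by
      rcases hm with hm | hm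
      · have h1 := (hm g u' v hg hu's hv).2 v hvs
        rw [sub_self, norm_zero, norm_le_zero_iff, sub_eq_zero] at h1
        exact h1.symm
      · exact (hm g u' v hg hu's hv).1 hvs
    rw [hmv]
    exact ⟨hvs, by simp⟩
  · have hη : 0 < ‖v - u'‖ := hθ.trans_lt hlt
    have hA0 : 0 < A := hη.trans_le hA
    have hθA : θ ^ 2 / A ≤ θ := by
      rw [div_le_iff₀ hA0, sq]
      exact mul_le_mul_of_nonneg_left (hlt.le.trans hA) hθ
    suffices h : m g u' v ∈ S.safeSet g ∧ ‖m g u' v - v‖ ≤ ‖v - u'‖ - θ from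
      ⟨h.1, h.2.trans ((by linarith : _ ≤ _).trans (le_max_left _ _))⟩
    rcases hm with hm | hm
    · obtain ⟨h1, h2⟩ := hm g u' v hg hu's hv
      refine ⟨h1, ?_⟩
      -- the point of the segment from `u'` to `v` at distance `θ` from `u'` is safe
      set ρ : ℝ := θ / ‖v - u'‖ with hρ
      have hρ0 : 0 ≤ ρ := by positivity
      have hρ1 : ρ ≤ 1 := (div_le_one hη).2 hlt.le
      have hρη : ρ * ‖v - u'‖ = θ := div_mul_cancel₀ _ hη.ne'
      have hw : ρ • v + (1 - ρ) • u' ∈ S.actionSet :=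
        hS.action_convex hv hu' hρ0 (by linarith) (by ring)
      have hwu : ρ • v + (1 - ρ) • u' - u' = ρ • (v - u') := by module
      have hvw : v - (ρ • v + (1 - ρ) • u') = (1 - ρ) • (v - u') := by module
      have h3 := h2 _ (hsafe _ hw (by
        rw [hwu, norm_smul, Real.norm_eq_abs, abs_of_nonneg hρ0, hρη]))
      rw [hvw, norm_smul, Real.norm_eq_abs, abs_of_nonneg (by linarith), sub_mul, hρη,
        one_mul] at h3
      rwa [norm_sub_rev]
    · obtain ⟨h1, h2⟩ := hm g u' v hg hu's hv
      by_cases hvs : v ∈ S.safeSet g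
      · rw [h1 hvs]
        refine ⟨hvs, ?_⟩
        simp only [sub_self, norm_zero]
        linarith
      · obtain ⟨ρ, hρ0, hρ1, hmρ, hg0⟩ := h2 hvs
        have hw : ρ • v + (1 - ρ) • u' ∈ S.actionSet :=
          hS.action_convex hv hu' hρ0 (by linarith) (by ring)
        rw [hmρ] at hg0 ⊢
        refine ⟨⟨hw, hg0.le⟩, ?_⟩
        have h3 := hgκ _ hw
        have hwu : ρ • v + (1 - ρ) • u' - u' = ρ • (v - u') := by module
        have hwv : ρ • v + (1 - ρ) • u' - v = -((1 - ρ) • (v - u')) := by module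
        rw [hwv, norm_neg, norm_smul, Real.norm_eq_abs, abs_of_nonneg (by linarith)]
        rw [hg0, hwu, norm_smul, Real.norm_eq_abs, abs_of_nonneg hρ0] at h3
        -- the constraint is tight only outside the open ball of radius `θ`
        have h4 : θ ≤ ρ * ‖v - u'‖ := by
          refine le_of_sq_le_sq ?_ (by positivity)
          have := nonneg_of_mul_nonneg_right h3 hκ
          linarith
        linarith

/-! ### Feasibility of the safe action sets -/

/-- The standing data of safety-aware learning: a regular system, the safety level, the
reservation weights, the map to the safe action set and an admissible prior. -/
structure SafeSetup (S : ControlSystem Y k d) (σx σu α β Lc P A lam C₂ : ℝ) (q : ℕ → ℝ)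
    (m : (Euc d → ℝ) → Euc d → Euc d → Euc d) (prior : Policy Y k d) : Prop where
  regular : S.Regular σx σu α β Lc P A
  lam_pos : 0 < lam
  one_lt : 1 < C₂
  weight_eq : q = S.reservationWeight (1 + 1 / Real.sqrt (1 + lam)) C₂ lam β σx
  map : S.IsProjectionMap m ∨ S.IsCombinationMap m
  prior_admissible : S.Admissible prior

/-- The coefficient `C₁ (1 + 1/λ) β/2` of the geometric sums in the reservation weights. -/
noncomputable def weightUnit (lam β : ℝ) : ℝ :=
  (1 + 1 / Real.sqrt (1 + lam)) * (1 + 1 / lam) * (β / 2)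

theorem one_lt_sqrt_one_add {lam : ℝ} (h : 0 < lam) : 1 < Real.sqrt (1 + lam) :=
  Real.lt_sqrt_of_sq_lt (by linarith)

/-- With `a = √(1+λ) - 1`, the constant `C₁ (1 + 1/λ)` is exactly `1 + 1/a`. -/
theorem weightUnit_eq {lam : ℝ} (h : 0 < lam) (β : ℝ) :
    weightUnit lam β = (1 + 1 / (Real.sqrt (1 + lam) - 1)) * (β / 2) := by
  have h1 := one_lt_sqrt_one_add h
  have h2 : lam = Real.sqrt (1 + lam) ^ 2 - 1 := by
    rw [Real.sq_sqrt (by linarith)]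
    ring
  unfold weightUnit
  set s := Real.sqrt (1 + lam) with hs
  have h3 : s - 1 ≠ 0 := by linarith
  have h4 : s ≠ 0 := by linarith
  have h5 : lam ≠ 0 := h.ne'
  congr 1
  field_simp
  rw [h2]
  ring

theorem weightUnit_pos {lam β : ℝ} (h : 0 < lam) (hβ : 0 < β) : 0 < weightUnit lam β := by
  have := one_lt_sqrt_one_add h
  unfold weightUnit
  positivity

/-- The invariant of a run of the learning-augmented policy: at state `x` with accumulated risk
`R`, the budget of the past rounds covers `R` and the reservation for the distance of `x` to the
state of the prior. -/
def SafeInvariant (S : ControlSystem Y k d) (lam β σx C₂ : ℝ) (q : ℕ → ℝ) (prior : Policy Y k d)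
    (y : ℕ → Y) (h : ℕ) (x : Euc k) (R : ℝ) : Prop :=
  x ∈ S.stateSet ∧
    R + (weightUnit lam β + C₂ * σx ^ 2 * q h) * ‖x - S.state prior y h‖ ^ 2
      ≤ (1 + lam) * ∑ i ∈ Finset.range h, S.roundRisk prior y i

/-- The factor `1 + C₂/(C₂-1) σu² ∑_{i<H-h} (C₂ σx²)^i` in the denominator of `G_h`. -/
noncomputable def gainFactor (S : ControlSystem Y k d) (σx σu C₂ : ℝ) (h : ℕ) : ℝ :=
  1 + C₂ / (C₂ - 1) * σu ^ 2 * ∑ i ∈ Finset.range (S.horizon - h), (C₂ * σx ^ 2) ^ i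

section Setup

variable {lam C₂ : ℝ} {q : ℕ → ℝ} {m : (Euc d → ℝ) → Euc d → Euc d → Euc d}
  {prior π π' : Policy Y k d} {y : ℕ → Y}

theorem SafeSetup.weight_apply (hT : SafeSetup S σx σu α β Lc P A lam C₂ q m prior) (h : ℕ) :
    q h = weightUnit lam β * ∑ i ∈ Finset.range (S.horizon - h), (C₂ * σx ^ 2) ^ i := by
  rw [hT.weight_eq]
  rfl

theorem SafeSetup.weight_nonneg (hT : SafeSetup S σx σu α β Lc P A lam C₂ q m prior) (h : ℕ) :
    0 ≤ q h := by
  rw [hT.weight_apply]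
  have := weightUnit_pos hT.lam_pos hT.regular.β_pos
  have := hT.one_lt
  positivity

theorem SafeSetup.weight_succ (hT : SafeSetup S σx σu α β Lc P A lam C₂ q m prior) {h : ℕ}
    (hh : h < S.horizon) : q h = weightUnit lam β + C₂ * σx ^ 2 * q (h + 1) := by
  rw [hT.weight_apply, hT.weight_apply, show S.horizon - h = S.horizon - (h + 1) + 1 by omega,
    Finset.sum_range_succ']
  simp only [pow_succ, ← Finset.sum_mul]
  ring

theorem SafeSetup.gainFactor_pos (hT : SafeSetup S σx σu α β Lc P A lam C₂ q m prior) (h : ℕ) :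
    0 < S.gainFactor σx σu C₂ h := by
  have h1 : 0 < C₂ - 1 := by linarith [hT.one_lt]
  have h2 : 0 < C₂ := by linarith
  unfold gainFactor
  positivity

/-- The key estimate on the excess: smoothness with `a = √(1+λ) - 1` pays for the displacement of
the state out of the reservation and leaves the slack `√(1+λ) (√(1+λ) - 1) r†_h`. -/
theorem SafeSetup.excess_le (hT : SafeSetup S σx σu α β Lc P A lam C₂ q m prior) {h : ℕ}
    {x : Euc k} {R : ℝ} (hI : S.SafeInvariant lam β σx C₂ q prior y h x R) {u : Euc d}
    (hu : u ∈ S.actionSet) :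
    S.excess lam q prior y h x R u
      ≤ weightUnit lam β * S.gainFactor σx σu C₂ h * ‖u - S.action prior y h‖ ^ 2
        - Real.sqrt (1 + lam) * (Real.sqrt (1 + lam) - 1) * S.roundRisk prior y h := by
  obtain ⟨hx, hR⟩ := hI
  have hS := hT.regular
  have hs := one_lt_sqrt_one_add hT.lam_pos
  have hs2 : Real.sqrt (1 + lam) ^ 2 = 1 + lam := Real.sq_sqrt (by linarith [hT.lam_pos])
  have hrisk := hS.risk_le h (y h) (S.state prior y h) x (S.action prior y h) u
    (a := Real.sqrt (1 + lam) - 1) (by linarith)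
  rw [← weightUnit_eq hT.lam_pos, add_sub_cancel] at hrisk
  have hdyn := hS.dyn_sub_le h (y h) hx (hS.state_mem hT.prior_admissible y h) hu
    (hS.action_mem hT.prior_admissible y h)
  set e := ‖x - S.state prior y h‖ with he
  set w := ‖u - S.action prior y h‖ with hw
  have hC : 0 < C₂ - 1 := by linarith [hT.one_lt]
  have hsq : ‖S.dyn h (y h) x u - S.dyn h (y h) (S.state prior y h) (S.action prior y h)‖ ^ 2
      ≤ C₂ * σx ^ 2 * e ^ 2 + C₂ / (C₂ - 1) * σu ^ 2 * w ^ 2 := by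
    refine (pow_le_pow_left₀ (norm_nonneg _) hdyn 2).trans ?_
    have h1 : C₂ * σx ^ 2 * e ^ 2 + C₂ / (C₂ - 1) * σu ^ 2 * w ^ 2 - (σx * e + σu * w) ^ 2
        = ((C₂ - 1) * (σx * e) - σu * w) ^ 2 / (C₂ - 1) := by
      field_simp
      ring
    have h2 : 0 ≤ ((C₂ - 1) * (σx * e) - σu * w) ^ 2 / (C₂ - 1) := by positivity
    linarith
  have hqsq := mul_le_mul_of_nonneg_left hsq (hT.weight_nonneg h)
  have hgain : weightUnit lam β * S.gainFactor σx σu C₂ h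
      = weightUnit lam β + q h * (C₂ / (C₂ - 1) * σu ^ 2) := by
    rw [hT.weight_apply, gainFactor]
    ring
  have hcum : S.cumRisk prior y h
      = ∑ i ∈ Finset.range h, S.roundRisk prior y i + S.roundRisk prior y h :=
    Finset.sum_range_succ _ _
  rw [hgain, excess, hcum]
  have hrr : S.risk h (y h) (S.state prior y h) (S.action prior y h) = S.roundRisk prior y h := rfl
  rw [hrr] at hrisk
  have hprod : Real.sqrt (1 + lam) * (Real.sqrt (1 + lam) - 1) * S.roundRisk prior y h
      = (1 + lam) * S.roundRisk prior y h - Real.sqrt (1 + lam) * S.roundRisk prior y h := by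
    rw [mul_sub, ← sq, hs2]
    ring
  rw [hprod]
  linarith

theorem Regular.continuousOn_excess (hS : S.Regular σx σu α β Lc P A) (lam : ℝ) (q : ℕ → ℝ)
    (prior : Policy Y k d) (y : ℕ → Y) (h : ℕ) {x : Euc k} (hx : x ∈ S.stateSet) (R : ℝ) :
    ContinuousOn (S.excess lam q prior y h x R) S.actionSet := by
  have h0 : Continuous fun u : Euc d => (WithLp.toLp 2 (x, u) : WithLp 2 (Euc k × Euc d)) :=
    (WithLp.prod_continuous_toLp 2 _ _).comp (continuous_const.prodMk continuous_id)
  have h3 : Continuous fun z : WithLp 2 (Euc k × Euc d) => S.risk h (y h) z.fst z.snd :=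
     continuous_of_differentiable_real (hS.risk_differentiable h (y h))
  have h1 : Continuous fun u : Euc d => S.risk h (y h) x u := h3.comp h0
  have h2 : ContinuousOn (fun u : Euc d => S.dyn h (y h) x u) S.actionSet := by
    refine (LipschitzOnWith.of_dist_le_mul (K := ⟨σu, hS.σu_nonneg⟩)
      fun u hu u' hu' => ?_).continuousOn
    rw [dist_eq_norm, dist_eq_norm]
    exact hS.dyn_lipschitz_action h (y h) x hx u hu u' hu'
  unfold excess
  fun_prop

/-- At a state that satisfies the invariant, the safety map yields a safe action, and moves the
proposed action by at most `[‖v - u†_h‖ - (√(1+λ) - 1)² G_h r†_h]⁺`. -/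
theorem SafeSetup.correction_le (hT : SafeSetup S σx σu α β Lc P A lam C₂ q m prior) {h : ℕ}
    {x : Euc k} {R : ℝ} (hI : S.SafeInvariant lam β σx C₂ q prior y h x R) {v : Euc d}
    (hv : v ∈ S.actionSet) :
    m (S.excess lam q prior y h x R) (S.action prior y h) v
        ∈ S.safeSet (S.excess lam q prior y h x R) ∧
      ‖m (S.excess lam q prior y h x R) (S.action prior y h) v - v‖
        ≤ max (‖v - S.action prior y h‖ - (Real.sqrt (1 + lam) - 1) ^ 2
            * S.gainG σx σu β A C₂ h * S.roundRisk prior y h) 0 := by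
  have hS := hT.regular
  have hD := hT.gainFactor_pos h
  have hU := weightUnit_pos hT.lam_pos hS.β_pos
  have hs := one_lt_sqrt_one_add hT.lam_pos
  have hβ := hS.β_pos
  have hr : 0 ≤ S.roundRisk prior y h := hS.risk_nonneg _ _ _ _
  set t : ℝ := (Real.sqrt (1 + lam) - 1) ^ 2 * (2 / (β * S.gainFactor σx σu C₂ h))
    * S.roundRisk prior y h with ht
  have ht0 : 0 ≤ t := by positivity
  have htG : (Real.sqrt (1 + lam) - 1) ^ 2 * S.gainG σx σu β A C₂ h * S.roundRisk prior y h
      = Real.sqrt t ^ 2 / A := by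
    rw [Real.sq_sqrt ht0, ht, show S.gainG σx σu β A C₂ h
      = 2 / (β * A * S.gainFactor σx σu C₂ h) from rfl,
      show β * A * S.gainFactor σx σu C₂ h = β * S.gainFactor σx σu C₂ h * A by ring,
      ← div_div]
    ring
  rw [htG]
  refine hS.correction_le hT.map (hS.continuousOn_excess lam q prior y h hI.1 R)
    (hS.action_mem hT.prior_admissible y h) hv (κ := weightUnit lam β * S.gainFactor σx σu C₂ h)
    (by positivity) (Real.sqrt_nonneg t) fun u hu => (hT.excess_le hI hu).trans (le_of_eq ?_)
  rw [Real.sq_sqrt ht0, mul_sub, ht, weightUnit_eq hT.lam_pos]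
  have h1 : Real.sqrt (1 + lam) - 1 ≠ 0 := by linarith
  field_simp
  ring

/-- Feasibility: the invariant holds along the whole run, because the excess of a safe action being
non-positive is the invariant of the next round. -/
theorem SafeSetup.safeInvariant (hT : SafeSetup S σx σu α β Lc P A lam C₂ q m prior)
    (hπ : S.Admissible π) {h : ℕ} (hh : h ≤ S.horizon) :
    S.SafeInvariant lam β σx C₂ q prior y h (S.safeRun lam q m prior π y h).1
      (S.safeRun lam q m prior π y h).2 := by
  induction h with
  | zero =>
    refine ⟨hT.regular.init_mem, ?_⟩
    simp [safeRun, state]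
  | succ h ih =>
    have ih := ih (by omega)
    have hsafe := (hT.correction_le ih (hπ.1 h _ ih.1 (prefixUpTo y h))).1
    refine ⟨hT.regular.dyn_mem h _ _ ih.1 _ hsafe.1, ?_⟩
    have h1 := hsafe.2
    rw [← hT.weight_succ hh]
    exact sub_nonpos.1 h1

theorem SafeSetup.safeState_mem (hT : SafeSetup S σx σu α β Lc P A lam C₂ q m prior)
    (hπ : S.Admissible π) {h : ℕ} (hh : h < S.horizon) :
    (S.safeRun lam q m prior π y h).1 ∈ S.stateSet :=
  (hT.safeInvariant hπ hh.le).1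

theorem SafeSetup.safeAction_mem (hT : SafeSetup S σx σu α β Lc P A lam C₂ q m prior)
    (hπ : S.Admissible π) {h : ℕ} (hh : h < S.horizon) :
    S.safeAction lam q m prior π y h ∈ S.actionSet :=
  (hT.correction_le (hT.safeInvariant hπ hh.le)
    (hπ.1 h _ (hT.safeState_mem hπ hh) (prefixUpTo y h))).1.1

/-! ### Comparison of losses -/

/-- Safety costs the comparator at most `B ∑ [δ_h - (√(1+λ) - 1)² G_h r†_h]⁺` on every context
sequence. -/
theorem SafeSetup.safeLoss_le (hT : SafeSetup S σx σu α β Lc P A lam C₂ q m prior)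
    (hπ : S.Admissible π) {Lπ : ℝ} (hL0 : 0 ≤ Lπ) (hL : S.PolicyLipschitz π Lπ) :
    S.safeLoss lam q m prior π y ≤ S.loss π y + S.constB σx σu Lc Lπ *
      ∑ h ∈ Finset.range S.horizon,
        max (‖S.action π y h - S.action prior y h‖ - (Real.sqrt (1 + lam) - 1) ^ 2
          * S.gainG σx σu β A C₂ h * S.roundRisk prior y h) 0 := by
  have hS := hT.regular
  have h1 := hS.sum_cost_sub_le (y := y) (x := fun h => (S.safeRun lam q m prior π y h).1)
    (x' := S.state π y) (u := S.safeAction lam q m prior π y) (u' := S.action π y)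
    (p := fun h => max (‖S.action π y h - S.action prior y h‖ - (Real.sqrt (1 + lam) - 1) ^ 2
          * S.gainG σx σu β A C₂ h * S.roundRisk prior y h) 0) (b := 2 * Lπ) (by positivity)
    (fun h => le_max_right _ _) (fun h hh => hT.safeState_mem hπ hh)
    (fun h _ => hS.state_mem hπ y h) (fun h hh => hT.safeAction_mem hπ hh)
    (fun h _ => hS.action_mem hπ y h) (fun h => rfl) (fun h => rfl) rfl fun h hh => by
      have hx := hT.safeState_mem (y := y) hπ hh
      set v := π h (S.safeRun lam q m prior π y h).1 (prefixUpTo y h) with hv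
      have h2 : ‖S.safeAction lam q m prior π y h - v‖ ≤ _ :=
        (hT.correction_le (hT.safeInvariant hπ hh.le) (hπ.1 h _ hx (prefixUpTo y h))).2
      have h3 : ‖v - S.action π y h‖ ≤ Lπ * ‖(S.safeRun lam q m prior π y h).1 - S.state π y h‖ :=
        hL h _ hx _ (hS.state_mem hπ y h) _
      have h4 := norm_sub_le_norm_sub_add_norm_sub v (S.action π y h) (S.action prior y h)
      have h5 := norm_sub_le_norm_sub_add_norm_sub (S.safeAction lam q m prior π y h) v
        (S.action π y h)
      have h6 : max (‖v - S.action prior y h‖ - (Real.sqrt (1 + lam) - 1) ^ 2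
          * S.gainG σx σu β A C₂ h * S.roundRisk prior y h) 0
          ≤ max (‖S.action π y h - S.action prior y h‖ - (Real.sqrt (1 + lam) - 1) ^ 2
          * S.gainG σx σu β A C₂ h * S.roundRisk prior y h) 0 + ‖v - S.action π y h‖ := by
        refine max_le ?_ (add_nonneg (le_max_right _ _) (norm_nonneg _))
        refine le_trans ?_ (add_le_add_left (le_max_left _ _) _)
        linarith
      linarith
  have h2 := (abs_le.1 h1).2
  have h3 : Lc * (1 + (1 + 2 * Lπ) * σu *
      ∑ i ∈ Finset.range S.horizon, (σx + σu * (2 * Lπ)) ^ i) = S.constB σx σu Lc Lπ := by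
    rw [constB, show σu * (2 * Lπ) = 2 * σu * Lπ by ring]
  rw [h3] at h2
  simp only [safeLoss, loss]
  linarith

theorem SafeSetup.abs_safeLoss_sub_le (hT : SafeSetup S σx σu α β Lc P A lam C₂ q m prior)
    (hπ : S.Admissible π) (hπ' : S.Admissible π') :
    |S.safeLoss lam q m prior π y - S.safeLoss lam q m prior π' y| ≤ S.constK σx σu Lc *
      ∑ h ∈ Finset.range S.horizon,
        ‖S.safeAction lam q m prior π y h - S.safeAction lam q m prior π' y h‖ := by
  have h1 := hT.regular.sum_cost_sub_le (y := y)
    (x := fun h => (S.safeRun lam q m prior π y h).1)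
    (x' := fun h => (S.safeRun lam q m prior π' y h).1) (u := S.safeAction lam q m prior π y)
    (u' := S.safeAction lam q m prior π' y)
    (p := fun h => ‖S.safeAction lam q m prior π y h - S.safeAction lam q m prior π' y h‖)
    (b := 0) le_rfl (fun h => norm_nonneg _) (fun h hh => hT.safeState_mem hπ hh)
    (fun h hh => hT.safeState_mem hπ' hh) (fun h hh => hT.safeAction_mem hπ hh)
    (fun h hh => hT.safeAction_mem hπ' hh) (fun h => rfl) (fun h => rfl) rfl fun h _ => by simp
  simpa [constK, safeLoss] using h1

theorem SafeSetup.safeLoss_nonneg (hT : SafeSetup S σx σu α β Lc P A lam C₂ q m prior)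
    (hπ : S.Admissible π) : 0 ≤ S.safeLoss lam q m prior π y :=
  Finset.sum_nonneg fun h hh => hT.regular.cost_nonneg h _ _
    (hT.safeState_mem hπ (Finset.mem_range.1 hh)) _ (hT.safeAction_mem hπ (Finset.mem_range.1 hh))

theorem SafeSetup.safeLoss_le_horizon_mul (hT : SafeSetup S σx σu α β Lc P A lam C₂ q m prior)
    (hπ : S.Admissible π) : S.safeLoss lam q m prior π y ≤ S.horizon * P := by
  have := Finset.sum_le_card_nsmul (Finset.range S.horizon)
    (fun h => S.cost h (y h) (S.safeRun lam q m prior π y h).1 (S.safeAction lam q m prior π y h))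
    P fun h hh => hT.regular.cost_le h _ _
      (hT.safeState_mem hπ (Finset.mem_range.1 hh)) _ (hT.safeAction_mem hπ (Finset.mem_range.1 hh))
  simpa [safeLoss] using this

end Setup

end ControlSystem

/-! ### McDiarmid's bounded difference inequality -/

section Concentration

open ProbabilityTheory Finset

variable {Ω : Type*} [MeasurableSpace Ω] {μ : Measure Ω} [IsProbabilityMeasure μ]

theorem integrable_of_measurable_of_abs_le {α : Type*} [MeasurableSpace α] {ν : Measure α}
    [IsFiniteMeasure ν] {X : α → ℝ} (hX : Measurable X) {C : ℝ} (hC : ∀ a, |X a| ≤ C) :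
    Integrable X ν :=
  Integrable.of_bound hX.aestronglyMeasurable C (Eventually.of_forall hC)

/-- The exponential moment form of McDiarmid's inequality, by induction on the number of
coordinates: Hoeffding's lemma applies to the first coordinate, and averaging over it preserves
bounded differences in the others. -/
theorem integral_exp_le_of_bounded_differences {n : ℕ} {X : (Fin n → Ω) → ℝ} (hX : Measurable X)
    {C c : ℝ} (hC : ∀ D, |X D| ≤ C)
    (hc : ∀ D t x, |X (Function.update D t x) - X D| ≤ c) (s : ℝ) :
    ∫ D, Real.exp (s * (X D - ∫ D', X D' ∂Measure.pi fun _ => μ)) ∂(Measure.pi fun _ => μ)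
      ≤ Real.exp (n * c ^ 2 * s ^ 2 / 2) := by
  induction n with
  | zero =>
    have h1 : ∀ D : Fin 0 → Ω, X D = X default := fun D => congrArg X (Subsingleton.elim _ _)
    simp [h1]
  | succ n ih =>
    set ν : Measure (Fin n → Ω) := Measure.pi fun _ => μ with hν
    have hmp := (measurePreserving_piFinSuccAbove (fun _ : Fin (n + 1) => μ) 0).symm
    have hsymm : ⇑(MeasurableEquiv.piFinSuccAbove (fun _ : Fin (n + 1) => Ω) 0).symm
        = fun z : Ω × (Fin n → Ω) => (Fin.cons z.1 z.2 : Fin (n + 1) → Ω) := by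
      funext z
      exact Fin.insertNth_zero' _ _
    have hcomp : ∀ F : (Fin (n + 1) → Ω) → ℝ,
        ∫ D, F D ∂(Measure.pi fun _ => μ)
          = ∫ z : Ω × (Fin n → Ω), F (Fin.cons z.1 z.2) ∂(μ.prod ν) := by
      intro F
      rw [← hmp.integral_comp', hsymm]
    have hcons : Measurable fun z : Ω × (Fin n → Ω) => (Fin.cons z.1 z.2 : Fin (n + 1) → Ω) :=
      hsymm ▸ hmp.measurable
    set Z : (Fin n → Ω) → ℝ := fun r => ∫ x, X (Fin.cons x r) ∂μ with hZ
    have hXc : Measurable fun z : Ω × (Fin n → Ω) => X (Fin.cons z.1 z.2) := hX.comp hcons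
    have hXr : ∀ r : Fin n → Ω, Measurable fun x => X (Fin.cons x r) := fun r =>
      hXc.comp (measurable_id.prodMk measurable_const)
    have hXri : ∀ r : Fin n → Ω, Integrable (fun x => X (Fin.cons x r)) μ := fun r =>
      integrable_of_measurable_of_abs_le (hXr r) fun _ => hC _
    have hZm : Measurable Z :=
      (StronglyMeasurable.integral_prod_left (f := fun x r => X (Fin.cons x r))
        hXc.stronglyMeasurable).measurable
    have hZC : ∀ r, |Z r| ≤ C := fun r => by
      have := norm_integral_le_of_norm_le_const (μ := μ) (f := fun x => X (Fin.cons x r)) (C := C)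
        (Eventually.of_forall fun x => hC _)
      simpa using this
    have hZc : ∀ r t x, |Z (Function.update r t x) - Z r| ≤ c := by
      intro r t x
      have h1 : Z (Function.update r t x) - Z r
          = ∫ w, (X (Fin.cons w (Function.update r t x)) - X (Fin.cons w r)) ∂μ :=
        (integral_sub (hXri _) (hXri _)).symm
      rw [h1]
      have := norm_integral_le_of_norm_le_const (μ := μ)
        (f := fun w => X (Fin.cons w (Function.update r t x)) - X (Fin.cons w r)) (C := c)
        (Eventually.of_forall fun w => by
          rw [Real.norm_eq_abs, Fin.cons_update]; exact hc _ _ _)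
      simpa using this
    have hEX : ∫ D, X D ∂(Measure.pi fun _ => μ) = ∫ r, Z r ∂ν := by
      rw [hcomp, integral_prod_symm _ (integrable_of_measurable_of_abs_le hXc fun _ => hC _)]
    have hih := ih hZm hZC hZc
    rw [hEX, hcomp]
    set e : ℝ := ∫ r, Z r ∂ν with he
    have hexpb : ∀ a b : ℝ, |a| ≤ C → |b| ≤ C →
        |Real.exp (s * (a - b))| ≤ Real.exp (|s| * (C + C)) := by
      intro a b ha hb
      rw [abs_of_pos (Real.exp_pos _)]
      apply Real.exp_le_exp.2
      calc s * (a - b) ≤ |s * (a - b)| := le_abs_self _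
        _ = |s| * |a - b| := abs_mul _ _
        _ ≤ |s| * (C + C) := by
          gcongr
          exact (abs_sub _ _).trans (add_le_add ha hb)
    have heC : |e| ≤ C := by
      have := norm_integral_le_of_norm_le_const (μ := ν) (f := Z) (C := C)
        (Eventually.of_forall fun x => hZC _)
      simpa using this
    have hint : Integrable (fun z : Ω × (Fin n → Ω) =>
        Real.exp (s * (X (Fin.cons z.1 z.2) - e))) (μ.prod ν) :=
      integrable_of_measurable_of_abs_le (by fun_prop) fun _ => hexpb _ _ (hC _) heC
    rw [integral_prod_symm _ hint]
    have hinner : ∀ r : Fin n → Ω, ∫ x, Real.exp (s * (X (Fin.cons x r) - e)) ∂μ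
        ≤ Real.exp (c ^ 2 * s ^ 2 / 2) * Real.exp (s * (Z r - e)) := by
      intro r
      have h1 : ∀ x, Real.exp (s * (X (Fin.cons x r) - e))
          = Real.exp (s * (X (Fin.cons x r) - Z r)) * Real.exp (s * (Z r - e)) := by
        intro x
        rw [← Real.exp_add]
        ring_nf
      simp only [h1]
      rw [integral_mul_const]
      gcongr
      -- the values of the first coordinate's section lie in an interval of length `2 * c`
      obtain ⟨x₀⟩ : Nonempty Ω := nonempty_of_isProbabilityMeasure μ
      have hIcc : ∀ x, X (Fin.cons x r)
          ∈ Set.Icc (X (Fin.cons x₀ r) - c) (X (Fin.cons x₀ r) + c) := by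
        intro x
        have := hc (Fin.cons x₀ r) 0 x
        rw [Fin.update_cons_zero, abs_le] at this
        constructor <;> linarith
      have hH := (hasSubgaussianMGF_of_mem_Icc (μ := μ) (hXr r).aemeasurable
        (Eventually.of_forall hIcc)).mgf_le s
      refine hH.trans (le_of_eq ?_)
      congr 2
      have hc0 : 0 ≤ c := (abs_nonneg _).trans (hc (Fin.cons x₀ r) 0 x₀)
      push_cast
      rw [show X (Fin.cons x₀ r) + c - (X (Fin.cons x₀ r) - c) = 2 * c by ring, Real.norm_eq_abs,
        abs_of_nonneg (by positivity)]
      ring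
    have hI1 : Integrable (fun r => Real.exp (s * (Z r - e))) ν :=
      integrable_of_measurable_of_abs_le (by fun_prop) fun _ => hexpb _ _ (hZC _) heC
    calc ∫ r, ∫ x, Real.exp (s * (X (Fin.cons x r) - e)) ∂μ ∂ν
        ≤ ∫ r, Real.exp (c ^ 2 * s ^ 2 / 2) * Real.exp (s * (Z r - e)) ∂ν :=
          integral_mono hint.integral_prod_right (hI1.const_mul _) hinner
      _ = Real.exp (c ^ 2 * s ^ 2 / 2) * ∫ r, Real.exp (s * (Z r - e)) ∂ν := integral_const_mul _ _
      _ ≤ Real.exp (c ^ 2 * s ^ 2 / 2) * Real.exp (n * c ^ 2 * s ^ 2 / 2) := by gcongr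
      _ = Real.exp ((n + 1 : ℕ) * c ^ 2 * s ^ 2 / 2) := by
          rw [← Real.exp_add]
          push_cast
          ring_nf

/-- **McDiarmid's inequality**, with a variance proxy that is four times the optimal one. -/
theorem measure_ge_le_of_bounded_differences {n : ℕ} {X : (Fin n → Ω) → ℝ} (hX : Measurable X)
    {C c : ℝ} (hC : ∀ D, |X D| ≤ C)
    (hc : ∀ D t x, |X (Function.update D t x) - X D| ≤ c) {T : ℝ} (hT : 0 ≤ T) :
    (Measure.pi fun _ => μ) {D | T ≤ X D - ∫ D', X D' ∂Measure.pi fun _ => μ}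
      ≤ ENNReal.ofReal (Real.exp (-T ^ 2 / (2 * (n * c ^ 2)))) := by
  set e : ℝ := ∫ D', X D' ∂Measure.pi fun _ => μ with he
  have hsub : HasSubgaussianMGF (fun D => X D - e) (Real.toNNReal (n * c ^ 2))
      (Measure.pi fun _ => μ) := by
    refine ⟨fun s => ?_, fun s => ?_⟩
    · refine integrable_of_measurable_of_abs_le (C := Real.exp (|s| * (C + |e|)))
        (by fun_prop) fun D => ?_
      rw [abs_of_pos (Real.exp_pos _)]
      apply Real.exp_le_exp.2
      calc s * (X D - e) ≤ |s * (X D - e)| := le_abs_self _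
        _ = |s| * |X D - e| := abs_mul _ _
        _ ≤ |s| * (C + |e|) := by
          gcongr
          exact (abs_sub _ _).trans (by gcongr; exact hC D)
    · have := integral_exp_le_of_bounded_differences (μ := μ) hX hC hc s
      rw [Real.coe_toNNReal _ (by positivity)]
      exact this
  have h := hsub.measure_ge_le hT
  rw [Real.coe_toNNReal _ (by positivity)] at h
  rw [← ENNReal.ofReal_toReal (measure_ne_top (Measure.pi fun _ => μ) _)]
  exact ENNReal.ofReal_le_ofReal h

end Concentration

/-! ### Symmetrization and finite classes -/

section Rademacher

open ProbabilityTheory Finset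

variable {Ω : Type*}

/-- The sign `±1` that a Boolean encodes. -/
noncomputable def boolSign (b : Bool) : ℝ := if b then 1 else -1

theorem abs_boolSign (b : Bool) : |boolSign b| = 1 := by cases b <;> simp [boolSign]

/-- The largest one-sided deviation `sup_i (n 𝔼 g_i - ∑_t g_i(D_t))` over the class `g`; it is
not divided by the sample size. -/
noncomputable def supDeviation [MeasurableSpace Ω] (μ : Measure Ω) (g : ℕ → Ω → ℝ) {n : ℕ}
    (D : Fin n → Ω) : ℝ :=
  ⨆ i, (n * ∫ ω, g i ω ∂μ - ∑ t, g i (D t))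

/-- The empirical Rademacher average `𝔼_σ sup_i ∑_t σ_t g_i(D_t)` of the class `g` on the sample
`D`; it is not divided by the sample size. -/
noncomputable def rademacherAverage (g : ℕ → Ω → ℝ) {n : ℕ} (D : Fin n → Ω) : ℝ :=
  (1 / 2 ^ n) * ∑ σ : Fin n → Bool, ⨆ i, ∑ t, boolSign (σ t) * g i (D t)

theorem abs_iSup_sub_iSup_le {a b : ℕ → ℝ} {c : ℝ} (ha : BddAbove (Set.range a))
    (hb : BddAbove (Set.range b)) (h : ∀ i, |a i - b i| ≤ c) : |(⨆ i, a i) - ⨆ i, b i| ≤ c := by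
  rw [abs_le]
  constructor
  · have : (⨆ i, b i) ≤ (⨆ i, a i) + c := ciSup_le fun i => by
      have h1 := le_ciSup ha i
      have h2 := (abs_le.1 (h i)).1
      linarith
    linarith
  · have : (⨆ i, a i) ≤ (⨆ i, b i) + c := ciSup_le fun i => by
      have h1 := le_ciSup hb i
      have h2 := (abs_le.1 (h i)).2
      linarith
    linarith

theorem bddAbove_of_abs_le {a : ℕ → ℝ} {c : ℝ} (h : ∀ i, |a i| ≤ c) :
    BddAbove (Set.range a) :=
  ⟨c, by rintro _ ⟨i, rfl⟩; exact (abs_le.1 (h i)).2⟩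

theorem abs_iSup_le {a : ℕ → ℝ} {c : ℝ} (h : ∀ i, |a i| ≤ c) : |⨆ i, a i| ≤ c := by
  rw [abs_le]
  exact ⟨(abs_le.1 (h 0)).1.trans (le_ciSup (bddAbove_of_abs_le h) 0),
    ciSup_le fun i => (abs_le.1 (h i)).2⟩

section Bounds

variable {n : ℕ} {M : ℝ}

theorem abs_sum_le_nat_mul {v : Fin n → ℝ} (h : ∀ t, |v t| ≤ M) : |∑ t, v t| ≤ n * M := by
  refine (Finset.abs_sum_le_sum_abs _ _).trans ?_
  simpa using Finset.sum_le_card_nsmul Finset.univ (fun t => |v t|) M fun t _ => h t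

theorem abs_sum_update_sub_le {F : Fin n → Ω → ℝ} {c : ℝ} (hF : ∀ t x y, |F t x - F t y| ≤ c)
    (D : Fin n → Ω) (t : Fin n) (x : Ω) :
    |∑ t', F t' (Function.update D t x t') - ∑ t', F t' (D t')| ≤ c := by
  rw [← Finset.sum_sub_distrib, Finset.sum_eq_single t]
  · simpa using hF t x (D t)
  · intro b _ hb
    simp [hb]
  · simp

theorem abs_boolSign_mul_le {b : Bool} {v : ℝ} (h : |v| ≤ M) : |boolSign b * v| ≤ M := by
  rwa [abs_mul, abs_boolSign, one_mul]

theorem abs_average_le {W : (Fin n → Bool) → ℝ} {c : ℝ} (h : ∀ σ, |W σ| ≤ c) :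
    |1 / 2 ^ n * ∑ σ, W σ| ≤ c := by
  have h1 : |∑ σ, W σ| ≤ 2 ^ n * c := by
    refine (Finset.abs_sum_le_sum_abs _ _).trans ?_
    simpa using Finset.sum_le_card_nsmul Finset.univ (fun t => |W t|) c fun t _ => h t
  rw [abs_mul, abs_of_pos (by positivity), one_div, inv_mul_le_iff₀ (by positivity)]
  exact h1

variable {g : ℕ → Ω → ℝ}

theorem abs_signed_sum_le (hM : ∀ i ω, |g i ω| ≤ M) (σ : Fin n → Bool) (D : Fin n → Ω) (i : ℕ) :
    |∑ t, boolSign (σ t) * g i (D t)| ≤ n * M :=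
  abs_sum_le_nat_mul fun t => abs_boolSign_mul_le (hM i (D t))

theorem abs_sub_le_two_mul {a b : ℝ} (ha : |a| ≤ M) (hb : |b| ≤ M) : |a - b| ≤ 2 * M := by
  have := abs_sub a b
  linarith

theorem abs_rademacherAverage_sub_le (hM : ∀ i ω, |g i ω| ≤ M) (D : Fin n → Ω) (t : Fin n)
    (x : Ω) :
    |rademacherAverage g (Function.update D t x) - rademacherAverage g D| ≤ 2 * M := by
  rw [rademacherAverage, rademacherAverage, ← mul_sub, ← Finset.sum_sub_distrib]
  refine abs_average_le fun σ => ?_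
  refine abs_iSup_sub_iSup_le (bddAbove_of_abs_le (abs_signed_sum_le hM _ _))
    (bddAbove_of_abs_le (abs_signed_sum_le hM _ _)) fun i => ?_
  exact abs_sum_update_sub_le (F := fun t ω => boolSign (σ t) * g i ω)
    (fun t x y => abs_sub_le_two_mul (abs_boolSign_mul_le (hM i x))
      (abs_boolSign_mul_le (hM i y))) D t x

variable [MeasurableSpace Ω] {μ : Measure Ω}

theorem measurable_supDeviation (hg : ∀ i, Measurable (g i)) :
    Measurable fun D : Fin n → Ω => supDeviation μ g D := by
  unfold supDeviation
  refine Measurable.iSup fun i => ?_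
  have := hg i
  fun_prop

theorem measurable_iSup_signed_sum (hg : ∀ i, Measurable (g i)) (σ : Fin n → Bool) :
    Measurable fun D : Fin n → Ω => ⨆ i, ∑ t, boolSign (σ t) * g i (D t) := by
  refine Measurable.iSup fun i => ?_
  have := hg i
  fun_prop

theorem measurable_rademacherAverage (hg : ∀ i, Measurable (g i)) :
    Measurable fun D : Fin n → Ω => rademacherAverage g D := by
  unfold rademacherAverage
  have := fun σ : Fin n → Bool => measurable_iSup_signed_sum hg σ
  fun_prop

variable [IsProbabilityMeasure μ]

theorem abs_integral_le_of_abs_le {α : Type*} [MeasurableSpace α] {ν : Measure α}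
    [IsProbabilityMeasure ν] {f : α → ℝ} (h : ∀ a, |f a| ≤ M) : |∫ a, f a ∂ν| ≤ M := by
  simpa using norm_integral_le_of_norm_le_const (μ := ν) (f := f) (C := M) (Eventually.of_forall h)

theorem abs_deviation_le (hM : ∀ i ω, |g i ω| ≤ M) (D : Fin n → Ω) (i : ℕ) :
    |n * ∫ ω, g i ω ∂μ - ∑ t, g i (D t)| ≤ 2 * n * M := by
  have h1 : |(n : ℝ) * ∫ ω, g i ω ∂μ| ≤ n * M := by
    rw [abs_mul, Nat.abs_cast]
    gcongr
    exact abs_integral_le_of_abs_le (hM i)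
  have h2 := abs_sum_le_nat_mul fun t => hM i (D t)
  have h3 := abs_sub (n * ∫ ω, g i ω ∂μ) (∑ t, g i (D t))
  linarith

theorem abs_supDeviation_sub_le (hM : ∀ i ω, |g i ω| ≤ M) (D : Fin n → Ω) (t : Fin n) (x : Ω) :
    |supDeviation μ g (Function.update D t x) - supDeviation μ g D| ≤ 2 * M := by
  refine abs_iSup_sub_iSup_le (bddAbove_of_abs_le (abs_deviation_le hM _))
    (bddAbove_of_abs_le (abs_deviation_le hM _)) fun i => ?_
  rw [sub_sub_sub_cancel_left, abs_sub_comm]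
  exact abs_sum_update_sub_le (F := fun _ => g i)
    (fun _ x y => abs_sub_le_two_mul (hM i x) (hM i y)) D t x

/-- The expectations in the deviation are replaced by the averages of an independent second
sample; the pairs of corresponding points are the coordinates of `z`. -/
theorem integral_supDeviation_le_ghost (hg : ∀ i, Measurable (g i)) (hM : ∀ i ω, |g i ω| ≤ M) :
    ∫ D, supDeviation μ g D ∂(Measure.pi fun _ : Fin n => μ)
      ≤ ∫ z, (⨆ i, ∑ t, (g i (z t).2 - g i (z t).1))
          ∂(Measure.pi fun _ : Fin n => μ.prod μ) := by
  set ν : Measure (Fin n → Ω) := Measure.pi fun _ => μ with hν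
  have hmp := measurePreserving_arrowProdEquivProdArrow Ω Ω (Fin n) (fun _ => μ) (fun _ => μ)
  have hdiff : ∀ D D' : Fin n → Ω, ∀ i, |∑ t, (g i (D' t) - g i (D t))| ≤ n * (2 * M) :=
    fun D D' i => abs_sum_le_nat_mul fun t => abs_sub_le_two_mul (hM i _) (hM i _)
  have hSm : Measurable fun p : (Fin n → Ω) × (Fin n → Ω) =>
      ⨆ i, ∑ t, (g i (p.2 t) - g i (p.1 t)) := by
    refine Measurable.iSup fun i => ?_
    have := hg i
    fun_prop
  have hSi : Integrable (fun p : (Fin n → Ω) × (Fin n → Ω) =>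
      ⨆ i, ∑ t, (g i (p.2 t) - g i (p.1 t))) (ν.prod ν) :=
    integrable_of_measurable_of_abs_le hSm fun p => abs_iSup_le (hdiff p.1 p.2)
  have h1 : ∫ z, (⨆ i, ∑ t, (g i (z t).2 - g i (z t).1)) ∂(Measure.pi fun _ : Fin n => μ.prod μ)
      = ∫ D, ∫ D', (⨆ i, ∑ t, (g i (D' t) - g i (D t))) ∂ν ∂ν := by
    rw [← integral_prod _ hSi, ← hmp.integral_comp']
    rfl
  rw [h1]
  refine integral_mono (integrable_of_measurable_of_abs_le (measurable_supDeviation hg)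
    fun D => abs_iSup_le (abs_deviation_le hM D)) hSi.integral_prod_left fun D => ?_
  refine ciSup_le fun i => ?_
  have hgi : ∀ t : Fin n, Integrable (fun D' : Fin n → Ω => g i (D' t)) ν := fun t =>
    integrable_of_measurable_of_abs_le ((hg i).comp (measurable_pi_apply t)) fun _ => hM i _
  have h2 : n * ∫ ω, g i ω ∂μ - ∑ t, g i (D t) = ∫ D', ∑ t, (g i (D' t) - g i (D t)) ∂ν := by
    have h4 : ∀ t : Fin n, Integrable (fun D' : Fin n → Ω => g i (D' t) - g i (D t)) ν := fun t =>
      (hgi t).sub (integrable_const _)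
    rw [integral_finsetSum _ fun t _ => h4 t]
    have h3 : ∀ t : Fin n, ∫ D', (g i (D' t) - g i (D t)) ∂ν = ∫ ω, g i ω ∂μ - g i (D t) := by
      intro t
      rw [integral_sub (hgi t) (integrable_const _),
        integral_comp_eval (μ := fun _ : Fin n => μ) (hg i).aestronglyMeasurable]
      simp
    simp [h3]
  rw [h2]
  refine integral_mono (integrable_finsetSum _ fun t _ => (hgi t).sub (integrable_const _))
    (integrable_of_measurable_of_abs_le (hSm.comp (measurable_const.prodMk measurable_id))
      fun D' => abs_iSup_le (hdiff D D')) fun D' => ?_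
  exact le_ciSup (bddAbove_of_abs_le (hdiff D D')) i

/-- Exchanging the two points of the pairs with `σ t = -1` preserves the law, so that the two
samples can be separated after the signs `σ` are inserted. -/
theorem integral_ghost_le (hg : ∀ i, Measurable (g i)) (hM : ∀ i ω, |g i ω| ≤ M)
    (σ : Fin n → Bool) :
    ∫ z, (⨆ i, ∑ t, (g i (z t).2 - g i (z t).1)) ∂(Measure.pi fun _ : Fin n => μ.prod μ)
      ≤ ∫ D, (⨆ i, ∑ t, boolSign (σ t) * g i (D t)) ∂(Measure.pi fun _ : Fin n => μ)
        + ∫ D, (⨆ i, ∑ t, boolSign (!σ t) * g i (D t)) ∂(Measure.pi fun _ : Fin n => μ) := by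
  set ζ : Measure (Fin n → Ω × Ω) := Measure.pi fun _ => μ.prod μ with hζ
  -- exchange the two copies in the coordinates with a negative sign
  set w : (t : Fin n) → Ω × Ω → Ω × Ω := fun t => if σ t then id else Prod.swap with hw
  have hwmp : MeasurePreserving (fun (z : Fin n → Ω × Ω) t => w t (z t)) ζ ζ := by
    refine measurePreserving_pi _ _ fun t => ?_
    simp only [hw]
    split_ifs
    · exact MeasurePreserving.id _
    · exact Measure.measurePreserving_swap
  have hfst : MeasurePreserving (fun (z : Fin n → Ω × Ω) t => (z t).1) ζ
      (Measure.pi fun _ => μ) :=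
    measurePreserving_pi _ _ fun t => measurePreserving_fst
  have hsnd : MeasurePreserving (fun (z : Fin n → Ω × Ω) t => (z t).2) ζ
      (Measure.pi fun _ => μ) :=
    measurePreserving_pi _ _ fun t => measurePreserving_snd
  have hSm : Measurable fun z : Fin n → Ω × Ω => ⨆ i, ∑ t, (g i (z t).2 - g i (z t).1) := by
    refine Measurable.iSup fun i => ?_
    have := hg i
    fun_prop
  have hA := fun τ : Fin n → Bool => measurable_iSup_signed_sum hg τ
  have hAi : ∀ τ : Fin n → Bool, Integrable
      (fun D : Fin n → Ω => ⨆ i, ∑ t, boolSign (τ t) * g i (D t)) (Measure.pi fun _ => μ) :=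
    fun τ => integrable_of_measurable_of_abs_le (hA τ)
      fun D => abs_iSup_le (abs_signed_sum_le hM _ D)
  have hmap : ∀ {f : (Fin n → Ω × Ω) → Fin n → Ω}, MeasurePreserving f ζ (Measure.pi fun _ => μ) →
      ∀ τ : Fin n → Bool, ∫ D, (⨆ i, ∑ t, boolSign (τ t) * g i (D t)) ∂(Measure.pi fun _ => μ)
        = ∫ z, (⨆ i, ∑ t, boolSign (τ t) * g i (f z t)) ∂ζ := by
    intro f hf τ
    rw [← hf.map_eq, integral_map hf.measurable.aemeasurable (hA τ).aestronglyMeasurable]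
  have hAi₂ : Integrable (fun z : Fin n → Ω × Ω => ⨆ i, ∑ t, boolSign (σ t) * g i (z t).2) ζ :=
    hsnd.integrable_comp_of_integrable (hAi σ)
  have hAi₁ : Integrable (fun z : Fin n → Ω × Ω => ⨆ i, ∑ t, boolSign (!σ t) * g i (z t).1) ζ :=
    hfst.integrable_comp_of_integrable (hAi fun t => !σ t)
  rw [hmap hsnd σ, hmap hfst fun t => !σ t, ← integral_add hAi₂ hAi₁]
  have hL : ∫ z, (⨆ i, ∑ t, (g i (z t).2 - g i (z t).1)) ∂ζ
      = ∫ z, (⨆ i, ∑ t, (g i (w t (z t)).2 - g i (w t (z t)).1)) ∂ζ := by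
    conv_lhs => rw [← hwmp.map_eq]
    rw [integral_map hwmp.measurable.aemeasurable hSm.aestronglyMeasurable]
  rw [hL]
  have hdiff : ∀ z : Fin n → Ω × Ω, ∀ i, |∑ t, (g i (z t).2 - g i (z t).1)| ≤ n * (2 * M) :=
    fun z i => abs_sum_le_nat_mul fun t => abs_sub_le_two_mul (hM i _) (hM i _)
  refine integral_mono (integrable_of_measurable_of_abs_le (hSm.comp hwmp.measurable)
    fun z => abs_iSup_le (hdiff _)) (hAi₂.add hAi₁) fun z => ?_
  refine ciSup_le fun i => ?_
  have h1 : ∑ t, (g i (w t (z t)).2 - g i (w t (z t)).1)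
      = ∑ t, boolSign (σ t) * g i (z t).2 + ∑ t, boolSign (!σ t) * g i (z t).1 := by
    rw [← Finset.sum_add_distrib]
    refine Finset.sum_congr rfl fun t _ => ?_
    cases hσ : σ t <;> simp [hw, hσ, boolSign] <;> ring
  rw [h1]
  exact add_le_add
    (le_ciSup (bddAbove_of_abs_le (abs_signed_sum_le hM σ fun t => (z t).2)) i)
    (le_ciSup (bddAbove_of_abs_le (abs_signed_sum_le hM (fun t => !σ t) fun t => (z t).1)) i)

/-- **Symmetrization**: the expected largest deviation is at most twice the expected Rademacher
average. -/
theorem integral_supDeviation_le (hg : ∀ i, Measurable (g i)) (hM : ∀ i ω, |g i ω| ≤ M) :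
    ∫ D, supDeviation μ g D ∂(Measure.pi fun _ : Fin n => μ)
      ≤ 2 * ∫ D, rademacherAverage g D ∂(Measure.pi fun _ : Fin n => μ) := by
  set a : (Fin n → Bool) → ℝ := fun σ =>
    ∫ D, (⨆ i, ∑ t, boolSign (σ t) * g i (D t)) ∂(Measure.pi fun _ : Fin n => μ) with ha
  have h1 : ∀ σ, ∫ D, supDeviation μ g D ∂(Measure.pi fun _ : Fin n => μ)
      ≤ a σ + a (fun t => !σ t) := fun σ =>
    (integral_supDeviation_le_ghost hg hM).trans (integral_ghost_le hg hM σ)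
  have h2 : ∫ D, rademacherAverage g D ∂(Measure.pi fun _ : Fin n => μ)
      = 1 / 2 ^ n * ∑ σ, a σ := by
    unfold rademacherAverage
    rw [integral_const_mul, integral_finsetSum _ fun σ _ => integrable_of_measurable_of_abs_le
      (measurable_iSup_signed_sum hg σ) fun D => abs_iSup_le (abs_signed_sum_le hM _ D)]
  have h3 : ∑ σ : Fin n → Bool, a (fun t => !σ t) = ∑ σ, a σ :=
    Equiv.sum_comp (Equiv.piCongrRight fun _ => Equiv.boolNot) a
  have h4 := Finset.sum_le_sum fun σ (_ : σ ∈ (Finset.univ : Finset (Fin n → Bool))) => h1 σ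
  rw [Finset.sum_add_distrib, h3] at h4
  simp only [Finset.sum_const, Finset.card_univ, Fintype.card_fun, Fintype.card_bool,
    Fintype.card_fin, nsmul_eq_mul, Nat.cast_pow, Nat.cast_ofNat] at h4
  rw [h2]
  have h5 : (0 : ℝ) < 2 ^ n := by positivity
  have h6 : 2 * (1 / 2 ^ n * ∑ σ, a σ) = (∑ σ, a σ + ∑ σ, a σ) / 2 ^ n := by ring
  rw [h6, le_div_iff₀ h5]
  linarith

/-- With high probability the largest deviation exceeds twice the Rademacher average *of the same
sample* by at most `T`: the difference has bounded differences and non-positive mean. -/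
theorem measure_supDeviation_ge_le (hg : ∀ i, Measurable (g i)) (hM : ∀ i ω, |g i ω| ≤ M)
    {T : ℝ} (hT : 0 ≤ T) :
    (Measure.pi fun _ : Fin n => μ) {D | T ≤ supDeviation μ g D - 2 * rademacherAverage g D}
      ≤ ENNReal.ofReal (Real.exp (-T ^ 2 / (2 * (n * (6 * M) ^ 2)))) := by
  set X : (Fin n → Ω) → ℝ := fun D => supDeviation μ g D - 2 * rademacherAverage g D with hX
  have hsup : ∀ D : Fin n → Ω, |supDeviation μ g D| ≤ 2 * n * M := fun D =>
    abs_iSup_le (abs_deviation_le hM D)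
  have hrad : ∀ D : Fin n → Ω, |rademacherAverage g D| ≤ n * M := fun D =>
    abs_average_le fun σ => abs_iSup_le (abs_signed_sum_le hM _ D)
  have hsupi := integrable_of_measurable_of_abs_le (ν := Measure.pi fun _ : Fin n => μ)
    (measurable_supDeviation (μ := μ) hg) hsup
  have hradi := integrable_of_measurable_of_abs_le (ν := Measure.pi fun _ : Fin n => μ)
    (measurable_rademacherAverage hg) hrad
  have hXm : Measurable X :=
    (measurable_supDeviation hg).sub ((measurable_rademacherAverage hg).const_mul 2)
  have hXC : ∀ D, |X D| ≤ 4 * n * M := fun D => by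
    have h1 := abs_sub (supDeviation μ g D) (2 * rademacherAverage g D)
    rw [abs_mul, abs_two] at h1
    have := hsup D
    have := hrad D
    linarith
  have hXc : ∀ D t x, |X (Function.update D t x) - X D| ≤ 6 * M := fun D t x => by
    have h1 := abs_supDeviation_sub_le (μ := μ) hM D t x
    have h2 := abs_rademacherAverage_sub_le hM D t x
    rw [abs_le] at *
    constructor <;> simp only [hX] <;> linarith
  have hmean : ∫ D, X D ∂(Measure.pi fun _ : Fin n => μ) ≤ 0 := by
    have := integral_supDeviation_le (n := n) (μ := μ) hg hM
    simp only [hX]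
    rw [integral_sub hsupi (hradi.const_mul 2), integral_const_mul]
    linarith
  refine (measure_mono fun D hD => ?_).trans
    (measure_ge_le_of_bounded_differences (μ := μ) hXm hXC hXc hT)
  simp only [Set.mem_ofPred_eq] at hD ⊢
  simp only [hX] at hmean ⊢
  linarith

end Bounds

theorem sum_exp_signed_sum {n : ℕ} (v : Fin n → ℝ) :
    ∑ σ : Fin n → Bool, Real.exp (∑ t, boolSign (σ t) * v t) = 2 ^ n * ∏ t, Real.cosh (v t) := by
  have h1 : ∀ t, ∑ b : Bool, Real.exp (boolSign b * v t) = 2 * Real.cosh (v t) := fun t => by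
    rw [Fintype.sum_bool, Real.cosh_eq]
    simp only [boolSign, if_true, Bool.false_eq_true, if_false, one_mul, neg_mul]
    ring
  simp only [Real.exp_sum]
  rw [← Fintype.prod_sum (fun t (b : Bool) => Real.exp (boolSign b * v t))]
  rw [Finset.prod_congr rfl fun t _ => h1 t, Finset.prod_mul_distrib]
  simp

/-- **Massart's lemma** with a free parameter `s`, for the maximum over a finite set `T` of
vectors. -/
theorem average_sup_le {n : ℕ} {T : Finset (Fin n → ℝ)} (hT : T.Nonempty) {M : ℝ}
    (hM : ∀ v ∈ T, ∀ t, |v t| ≤ M) {s : ℝ} (hs : 0 < s) :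
    1 / 2 ^ n * ∑ σ : Fin n → Bool, T.sup' hT (fun v => ∑ t, boolSign (σ t) * v t)
      ≤ Real.log T.card / s + s * n * M ^ 2 / 2 := by
  set W : (Fin n → Bool) → ℝ := fun σ => T.sup' hT (fun v => ∑ t, boolSign (σ t) * v t) with hW
  have hcard : (0 : ℝ) < T.card := by exact_mod_cast hT.card_pos
  set c : ℝ := Real.log T.card / s + s * n * M ^ 2 / 2 with hc
  have hsc : Real.exp (s * c) = T.card * Real.exp (n * (s ^ 2 * M ^ 2 / 2)) := by
    rw [hc, mul_add, Real.exp_add, mul_div_cancel₀ _ hs.ne', Real.exp_log hcard]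
    ring_nf
  -- `1 + x ≤ exp x` replaces Jensen's inequality
  have hpt : ∀ σ, W σ ≤ c + (Real.exp (s * W σ) * Real.exp (-(s * c)) - 1) / s := by
    intro σ
    rw [← Real.exp_add, ← sub_le_iff_le_add', le_div_iff₀ hs]
    have := Real.add_one_le_exp (s * W σ + -(s * c))
    linarith
  have hexp : ∑ σ, Real.exp (s * W σ) ≤ 2 ^ n * Real.exp (s * c) := by
    calc ∑ σ, Real.exp (s * W σ)
        ≤ ∑ σ : Fin n → Bool, ∑ v ∈ T, Real.exp (∑ t, boolSign (σ t) * (s * v t)) := by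
          refine Finset.sum_le_sum fun σ _ => ?_
          obtain ⟨v, hv, hv'⟩ := T.exists_mem_eq_sup' hT (fun v => ∑ t, boolSign (σ t) * v t)
          have h1 : s * W σ = ∑ t, boolSign (σ t) * (s * v t) := by
            simp only [hW]
            rw [hv', Finset.mul_sum]
            exact Finset.sum_congr rfl fun t _ => by ring
          rw [h1]
          exact Finset.single_le_sum (f := fun v => Real.exp (∑ t, boolSign (σ t) * (s * v t)))
            (fun _ _ => (Real.exp_pos _).le) hv
      _ = ∑ v ∈ T, 2 ^ n * ∏ t, Real.cosh (s * v t) := by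
          rw [Finset.sum_comm]
          exact Finset.sum_congr rfl fun v _ => sum_exp_signed_sum _
      _ ≤ ∑ v ∈ T, 2 ^ n * Real.exp (n * (s ^ 2 * M ^ 2 / 2)) := by
          refine Finset.sum_le_sum fun v hv => ?_
          gcongr
          calc ∏ t, Real.cosh (s * v t) ≤ ∏ _t : Fin n, Real.exp (s ^ 2 * M ^ 2 / 2) := by
                refine Finset.prod_le_prod (fun t _ => (Real.cosh_pos _).le) fun t _ => ?_
                refine (Real.cosh_le_exp_half_sq _).trans (Real.exp_le_exp.2 ?_)
                rw [mul_pow]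
                have := sq_le_sq' (abs_le.1 (hM v hv t)).1 (abs_le.1 (hM v hv t)).2
                gcongr
            _ = Real.exp (n * (s ^ 2 * M ^ 2 / 2)) := by
                rw [Finset.prod_const, Finset.card_univ, Fintype.card_fin, ← Real.exp_nat_mul]
      _ = 2 ^ n * Real.exp (s * c) := by
          rw [hsc, Finset.sum_const, nsmul_eq_mul]
          ring
  have h2 : (0 : ℝ) < 2 ^ n := by positivity
  rw [one_div, inv_mul_le_iff₀ h2]
  calc ∑ σ, W σ ≤ ∑ σ, (c + (Real.exp (s * W σ) * Real.exp (-(s * c)) - 1) / s) :=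
        Finset.sum_le_sum fun σ _ => hpt σ
    _ = 2 ^ n * c + ((∑ σ, Real.exp (s * W σ)) * Real.exp (-(s * c)) - 2 ^ n) / s := by
        rw [Finset.sum_add_distrib, ← Finset.sum_div, Finset.sum_sub_distrib, ← Finset.sum_mul]
        simp
    _ ≤ 2 ^ n * c + (2 ^ n * Real.exp (s * c) * Real.exp (-(s * c)) - 2 ^ n) / s := by gcongr
    _ = 2 ^ n * c := by
        rw [mul_assoc, ← Real.exp_add]
        simp

/-- The Rademacher average of a class that a finite set `T` of vectors covers on the sample. -/
theorem rademacherAverage_le_of_cover {g : ℕ → Ω → ℝ} {n : ℕ} (hn : 0 < n) {D : Fin n → Ω} {M : ℝ}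
    (hM0 : 0 < M) {T : Finset (Fin n → ℝ)} (hM : ∀ v ∈ T, ∀ t, |v t| ≤ M) {N η : ℝ} (hN : 1 < N)
    (hTN : T.card ≤ N) (hcov : ∀ i, ∃ v ∈ T, ∑ t, |g i (D t) - v t| ≤ η) :
    rademacherAverage g D ≤ η + M * Real.sqrt (2 * n * Real.log N) := by
  have hT : T.Nonempty := by
    obtain ⟨v, hv, -⟩ := hcov 0
    exact ⟨v, hv⟩
  have hcard : (0 : ℝ) < T.card := by exact_mod_cast hT.card_pos
  have hlog : 0 < Real.log N := Real.log_pos hN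
  have hn' : (0 : ℝ) < n := by exact_mod_cast hn
  set r : ℝ := Real.sqrt (2 * n * Real.log N) with hr
  have hr0 : 0 < r := Real.sqrt_pos.2 (by positivity)
  have hr2 : r ^ 2 = 2 * n * Real.log N := Real.sq_sqrt (by positivity)
  have h1 := average_sup_le hT hM (s := r / (n * M)) (by positivity)
  have h2 : Real.log T.card / (r / (n * M)) + r / (n * M) * n * M ^ 2 / 2 ≤ M * r := by
    have h3 : Real.log T.card ≤ r ^ 2 / (2 * n) := by
      rw [hr2, mul_assoc, mul_div_mul_left _ _ two_ne_zero, mul_div_cancel_left₀ _ hn'.ne']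
      exact Real.log_le_log hcard hTN
    calc Real.log T.card / (r / (n * M)) + r / (n * M) * n * M ^ 2 / 2
        ≤ r ^ 2 / (2 * n) / (r / (n * M)) + r / (n * M) * n * M ^ 2 / 2 := by gcongr
      _ = M * r := by
          field_simp
          ring
  have h4 : rademacherAverage g D
      ≤ 1 / 2 ^ n * ∑ σ : Fin n → Bool, (η + T.sup' hT (fun v => ∑ t, boolSign (σ t) * v t)) := by
    unfold rademacherAverage
    gcongr with σ
    refine ciSup_le fun i => ?_
    obtain ⟨v, hv, hv'⟩ := hcov i
    have h5 := Finset.le_sup' (fun v => ∑ t, boolSign (σ t) * v t) hv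
    have h6 : ∑ t, boolSign (σ t) * g i (D t) - ∑ t, boolSign (σ t) * v t
        ≤ ∑ t, |g i (D t) - v t| := by
      rw [← Finset.sum_sub_distrib]
      refine Finset.sum_le_sum fun t _ => ?_
      rw [← mul_sub]
      refine (le_abs_self _).trans (le_of_eq ?_)
      rw [abs_mul, abs_boolSign, one_mul]
    linarith
  have h7 : 1 / 2 ^ n * ∑ σ : Fin n → Bool, (η + T.sup' hT (fun v => ∑ t, boolSign (σ t) * v t))
      = η + 1 / 2 ^ n * ∑ σ : Fin n → Bool, T.sup' hT (fun v => ∑ t, boolSign (σ t) * v t) := by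
    rw [Finset.sum_add_distrib, mul_add]
    simp
  linarith

end Rademacher

/-! ### Empirical risk minimization with an empirical covering number -/

section EmpiricalRisk

variable {Ω : Type*} [MeasurableSpace Ω] {μ : Measure Ω} [IsProbabilityMeasure μ]

theorem abs_sub_le_of_mem_Icc {a b M : ℝ} (ha : a ∈ Set.Icc 0 M) (hb : b ∈ Set.Icc 0 M) :
    |a - b| ≤ M := by
  rw [abs_le]
  constructor <;> linarith [ha.1, ha.2, hb.1, hb.2]

/-- Generalization bound for empirical minimizers over the losses `ℓ`, relative to the competitor
`i₀`.  The losses `ℓ (e j)` of a sequence of indices are dense for pointwise convergence, and on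
every sample `D` a set of at most `N D` indices covers the class up to `η`.

The excess over the competitor is bounded by a single quantity with bounded differences, so no
union bound is needed, and the cover of cardinality at most `N D / δ` keeps the logarithm in
Massart's lemma positive also when `N D = 1`. -/
theorem measure_empirical_minimizer_bad_le {I : Type*} {ℓ : I → Ω → ℝ} {M : ℝ}
    (hℓ : ∀ i, Measurable (ℓ i)) (hM : ∀ i ω, ℓ i ω ∈ Set.Icc 0 M) (i₀ : I) {e : ℕ → I}
    (hdense : ∀ i, ∃ p : ℕ → ℕ, ∀ ω, Tendsto (fun j => ℓ (e (p j)) ω) atTop (𝓝 (ℓ i ω)))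
    {n : ℕ} (hn : 0 < n) {η : ℝ} (hη : 0 ≤ η) {N : (Fin n → Ω) → ℕ}
    (hN : ∀ D : Fin n → Ω, ∃ T : Finset I, T.card ≤ N D ∧
      ∀ i, ∃ j ∈ T, ∑ t, |ℓ i (D t) - ℓ j (D t)| ≤ n * η)
    {δ : ℝ} (hδ : 0 < δ) (hδ1 : δ < 1) :
    (Measure.pi fun _ : Fin n => μ) {D | ∃ i, (∀ j, ∑ t, ℓ i (D t) ≤ ∑ t, ℓ j (D t)) ∧
        ∫ ω, ℓ i₀ ω ∂μ + (12 * (M * Real.sqrt (1 / (n : ℝ) * Real.log (N D / δ))) + 2 * η)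
          < ∫ ω, ℓ i ω ∂μ}
      ≤ ENNReal.ofReal δ := by
  classical
  obtain ⟨ω₀⟩ : Nonempty Ω := nonempty_of_isProbabilityMeasure μ
  have hM0 : 0 ≤ M := (hM i₀ ω₀).1.trans (hM i₀ ω₀).2
  have hn' : (0 : ℝ) < n := by exact_mod_cast hn
  rcases hM0.eq_or_lt with hM0 | hM0
  · -- all losses vanish
    have hz : ∀ i ω, ℓ i ω = 0 := fun i ω => le_antisymm (hM0 ▸ (hM i ω).2) (hM i ω).1
    refine le_of_eq_of_le ?_ (zero_le (a := ENNReal.ofReal δ))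
    convert measure_empty (μ := Measure.pi fun _ : Fin n => μ)
    rw [Set.eq_empty_iff_forall_notMem]
    rintro D ⟨i, -, hi⟩
    simp only [hz, ← hM0] at hi
    simp at hi
    linarith
  set g : I → Ω → ℝ := fun i ω => ℓ i ω - ℓ i₀ ω with hg
  have hgm : ∀ i, Measurable (g i) := fun i => (hℓ i).sub (hℓ i₀)
  have hgM : ∀ i ω, |g i ω| ≤ M := fun i ω => abs_sub_le_of_mem_Icc (hM i ω) (hM i₀ ω)
  have hℓi : ∀ i, Integrable (ℓ i) μ := fun i =>
    integrable_of_measurable_of_abs_le (hℓ i) (C := M) fun ω => by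
      rw [abs_of_nonneg (hM i ω).1]
      exact (hM i ω).2
  have hgint : ∀ i, ∫ ω, g i ω ∂μ = ∫ ω, ℓ i ω ∂μ - ∫ ω, ℓ i₀ ω ∂μ := fun i =>
    integral_sub (hℓi i) (hℓi i₀)
  have hGM : ∀ j ω, |g (e j) ω| ≤ M := fun j ω => hgM _ _
  -- by density, the supremum over the sequence bounds the deviation of every member of the class
  have hsup : ∀ (D : Fin n → Ω) i,
      n * ∫ ω, g i ω ∂μ - ∑ t, g i (D t) ≤ supDeviation μ (fun j => g (e j)) D := by
    intro D i
    obtain ⟨p, hp⟩ := hdense i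
    have hpg : ∀ ω, Tendsto (fun j => g (e (p j)) ω) atTop (𝓝 (g i ω)) := fun ω =>
      (hp ω).sub_const _
    have h1 : Tendsto (fun j => ∫ ω, g (e (p j)) ω ∂μ) atTop (𝓝 (∫ ω, g i ω ∂μ)) :=
      tendsto_integral_of_dominated_convergence (fun _ => M)
        (fun j => (hgm _).aestronglyMeasurable) (integrable_const _)
        (fun j => Eventually.of_forall fun ω => hgM _ _) (Eventually.of_forall hpg)
    have h2 : Tendsto (fun j => n * ∫ ω, g (e (p j)) ω ∂μ - ∑ t, g (e (p j)) (D t)) atTop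
        (𝓝 (n * ∫ ω, g i ω ∂μ - ∑ t, g i (D t))) :=
      (h1.const_mul _).sub (tendsto_finsetSum _ fun t _ => hpg (D t))
    exact le_of_tendsto' h2 fun j =>
      le_ciSup (f := fun j => n * ∫ ω, g (e j) ω ∂μ - ∑ t, g (e j) (D t))
        (bddAbove_of_abs_le (abs_deviation_le hGM D)) (p j)
  set T : ℝ := M * Real.sqrt (72 * n * Real.log (1 / δ)) with hT
  have hlogδ : 0 < Real.log (1 / δ) := Real.log_pos (by rwa [one_lt_div hδ])
  have htail : Real.exp (-T ^ 2 / (2 * (n * (6 * M) ^ 2))) = δ := by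
    have h1 : -T ^ 2 / (2 * (n * (6 * M) ^ 2)) = -Real.log (1 / δ) := by
      rw [hT, mul_pow, Real.sq_sqrt (by positivity)]
      field_simp
      ring
    rw [h1, one_div, Real.log_inv, neg_neg, Real.exp_log hδ]
  refine (measure_mono fun D hD => ?_).trans ((measure_supDeviation_ge_le
    (fun j => hgm (e j)) hGM (T := T) (by positivity)).trans (by rw [htail]))
  obtain ⟨i, hmin, hbad⟩ := hD
  by_contra hlt
  simp only [Set.mem_ofPred_eq, not_le] at hlt
  obtain ⟨C, hCcard, hC⟩ := hN D
  have hN1 : (1 : ℝ) ≤ N D := by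
    obtain ⟨j, hj, -⟩ := hC i₀
    exact_mod_cast (Finset.card_pos.2 ⟨j, hj⟩).trans_le hCcard
  set L : ℝ := Real.log (N D / δ) with hL
  have hNδ : (N D : ℝ) ≤ N D / δ := by
    rw [le_div_iff₀ hδ]
    nlinarith
  have hNδ1 : 1 < (N D : ℝ) / δ := by
    rw [one_lt_div hδ]
    linarith
  have hrad := rademacherAverage_le_of_cover (g := fun j => g (e j)) hn (D := D) hM0
    (T := C.image fun j t => g j (D t)) (N := N D / δ) (η := n * η)
    (by
      intro v hv t
      obtain ⟨j, -, rfl⟩ := Finset.mem_image.1 hv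
      exact hgM _ _)
    hNδ1
    (le_trans (by exact_mod_cast Finset.card_image_le.trans hCcard) hNδ)
    (by
      intro j
      obtain ⟨j', hj', hj''⟩ := hC (e j)
      refine ⟨_, Finset.mem_image_of_mem _ hj', ?_⟩
      simpa only [hg, sub_sub_sub_cancel_right] using hj'')
  have h1 := hsup D i
  have h2 : ∑ t, g i (D t) ≤ 0 := by
    simp only [hg, Finset.sum_sub_distrib]
    linarith [hmin i₀]
  have hlogL : Real.log (1 / δ) ≤ L :=
    Real.log_le_log (by positivity) (by gcongr)
  have hL0 : 0 ≤ L := hlogδ.le.trans hlogL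
  set r : ℝ := Real.sqrt (n * L) with hr
  have hT9 : T ≤ 9 * (M * r) := by
    have : Real.sqrt (72 * n * Real.log (1 / δ)) ≤ 9 * r := by
      rw [hr, Real.sqrt_le_left (by positivity), mul_pow, Real.sq_sqrt (by positivity)]
      nlinarith [mul_le_mul_of_nonneg_left hlogL hn'.le, mul_nonneg hn'.le hL0]
    rw [hT]
    nlinarith
  have hrad3 : 2 * (M * Real.sqrt (2 * n * L)) ≤ 3 * (M * r) := by
    have : 2 * Real.sqrt (2 * n * L) ≤ 3 * r := by
      rw [← abs_of_nonneg (by positivity : 0 ≤ 3 * r)]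
      refine abs_le_abs_of_nonneg (by positivity) ?_ |>.trans' (le_abs_self _)
      refine le_of_sq_le_sq ?_ (by positivity)
      rw [mul_pow, mul_pow, hr, Real.sq_sqrt (by positivity), Real.sq_sqrt (by positivity)]
      nlinarith [mul_nonneg hn'.le hL0]
    nlinarith
  have hnr : n * Real.sqrt (1 / (n : ℝ) * L) = r := by
    rw [hr, ← Real.sqrt_sq hn'.le, ← Real.sqrt_mul (by positivity), Real.sqrt_sq hn'.le]
    congr 1
    field_simp
  have hfin : n * ∫ ω, g i ω ∂μ ≤ 12 * (M * r) + 2 * (n * η) := by linarith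
  have hbad' := mul_lt_mul_of_pos_left hbad hn'
  rw [hgint] at hfin
  have h5 : n * (12 * (M * Real.sqrt (1 / (n : ℝ) * L))) = 12 * (M * r) := by
    rw [← hnr]
    ring
  have h6 : n * (∫ ω, ℓ i₀ ω ∂μ + (12 * (M * Real.sqrt (1 / (n : ℝ) * L)) + 2 * η))
      = n * ∫ ω, ℓ i₀ ω ∂μ + 12 * (M * r) + 2 * (n * η) := by
    rw [← h5]
    ring
  rw [h6] at hbad'
  linarith

end EmpiricalRisk

namespace ControlSystem

variable {Y : Type*} [MeasurableSpace Y] {k d : ℕ} {S : ControlSystem Y k d}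
  {σx σu α β Lc P A : ℝ}

/-! ### Measurability -/

theorem measurable_prefixUpTo (h : ℕ) : Measurable fun y : ℕ → Y => prefixUpTo y h :=
  measurable_pi_lambda _ fun i => measurable_pi_apply (i : ℕ)

theorem Regular.measurable_state (hS : S.Regular σx σu α β Lc P A) {π : Policy Y k d}
    (hπ : S.Admissible π) (h : ℕ) : Measurable fun y => S.state π y h := by
  induction h with
  | zero => exact measurable_const
  | succ h ih =>
    exact (hS.measurable_dyn h).comp ((measurable_pi_apply h).prodMk
      (ih.prodMk ((hπ.2 h).comp (ih.prodMk (measurable_prefixUpTo h)))))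

theorem Regular.measurable_action (hS : S.Regular σx σu α β Lc P A) {π : Policy Y k d}
    (hπ : S.Admissible π) (h : ℕ) : Measurable fun y => S.action π y h :=
  (hπ.2 h).comp ((hS.measurable_state hπ h).prodMk (measurable_prefixUpTo h))

theorem Regular.measurable_loss (hS : S.Regular σx σu α β Lc P A) {π : Policy Y k d}
    (hπ : S.Admissible π) : Measurable fun y => S.loss π y :=
  Finset.measurable_fun_sum _ fun h _ => (hS.measurable_cost h).comp ((measurable_pi_apply h).prodMk
    ((hS.measurable_state hπ h).prodMk (hS.measurable_action hπ h)))

theorem Regular.measurable_roundRisk (hS : S.Regular σx σu α β Lc P A) {π : Policy Y k d}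
    (hπ : S.Admissible π) (h : ℕ) : Measurable fun y => S.roundRisk π y h :=
  (hS.measurable_risk h).comp ((measurable_pi_apply h).prodMk
    ((hS.measurable_state hπ h).prodMk (hS.measurable_action hπ h)))

section Setup

variable {lam C₂ : ℝ} {q : ℕ → ℝ} {m : (Euc d → ℝ) → Euc d → Euc d → Euc d}
  {prior π : Policy Y k d}

theorem Regular.measurable_safeState (hS : S.Regular σx σu α β Lc P A)
    (hm : ∀ h < S.horizon, Measurable fun y => S.safeAction lam q m prior π y h) {h : ℕ}
    (hh : h ≤ S.horizon) : Measurable fun y => (S.safeRun lam q m prior π y h).1 := by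
  induction h with
  | zero => exact measurable_const
  | succ h ih =>
    exact (hS.measurable_dyn h).comp ((measurable_pi_apply h).prodMk
      ((ih (by omega)).prodMk (hm h hh)))

theorem Regular.measurable_safeLoss (hS : S.Regular σx σu α β Lc P A)
    (hm : ∀ h < S.horizon, Measurable fun y => S.safeAction lam q m prior π y h) :
    Measurable fun y => S.safeLoss lam q m prior π y :=
  Finset.measurable_fun_sum _ fun h hh => (hS.measurable_cost h).comp
    ((measurable_pi_apply h).prodMk
      ((hS.measurable_safeState hm (Finset.mem_range.1 hh).le).prodMk
        (hm h (Finset.mem_range.1 hh))))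

theorem SafeSetup.tendsto_safeLoss (hT : SafeSetup S σx σu α β Lc P A lam C₂ q m prior)
    (hπ : S.Admissible π) {p : ℕ → Policy Y k d} (hp : ∀ i, S.Admissible (p i)) {y : ℕ → Y}
    (hlim : ∀ h < S.horizon, Tendsto (fun i => S.safeAction lam q m prior (p i) y h) atTop
      (𝓝 (S.safeAction lam q m prior π y h))) :
    Tendsto (fun i => S.safeLoss lam q m prior (p i) y) atTop
      (𝓝 (S.safeLoss lam q m prior π y)) := by
  rw [tendsto_iff_norm_sub_tendsto_zero]
  refine squeeze_zero (fun _ => norm_nonneg _) (fun i => hT.abs_safeLoss_sub_le (hp i) hπ) ?_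
  have h1 : Tendsto (fun i => ∑ h ∈ Finset.range S.horizon,
      ‖S.safeAction lam q m prior (p i) y h - S.safeAction lam q m prior π y h‖) atTop
      (𝓝 (∑ _h ∈ Finset.range S.horizon, 0)) :=
    tendsto_finsetSum _ fun h hh =>
      tendsto_iff_norm_sub_tendsto_zero.1 (hlim h (Finset.mem_range.1 hh))
  simpa using h1.const_mul (S.constK σx σu Lc)

/-- The expected loss of the safe version of the comparator. -/
theorem SafeSetup.integral_safeLoss_le (hT : SafeSetup S σx σu α β Lc P A lam C₂ q m prior)
    (hπ : S.Admissible π)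
    (hm : ∀ h < S.horizon, Measurable fun y => S.safeAction lam q m prior π y h)
    {Lπ : ℝ} (hL0 : 0 ≤ Lπ) (hL : S.PolicyLipschitz π Lπ) (μ : Measure (ℕ → Y))
    [IsProbabilityMeasure μ] :
    ∫ y, S.safeLoss lam q m prior π y ∂μ ≤ ∫ y, S.loss π y ∂μ + S.constB σx σu Lc Lπ *
      ∫ y, ∑ h ∈ Finset.range S.horizon,
        max (‖S.action π y h - S.action prior y h‖ - (Real.sqrt (1 + lam) - 1) ^ 2
          * S.gainG σx σu β A C₂ h * S.roundRisk prior y h) 0 ∂μ := by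
  have hS := hT.regular
  have hsafe : Integrable (fun y => S.safeLoss lam q m prior π y) μ :=
    integrable_of_measurable_of_abs_le (hS.measurable_safeLoss hm) (C := S.horizon * P) fun y => by
      rw [abs_of_nonneg (hT.safeLoss_nonneg hπ)]
      exact hT.safeLoss_le_horizon_mul hπ
  have hloss : Integrable (fun y => S.loss π y) μ := by
    refine integrable_of_measurable_of_abs_le (hS.measurable_loss hπ)
      (C := ∑ _h ∈ Finset.range S.horizon, P) fun y => ?_
    refine (Finset.abs_sum_le_sum_abs _ _).trans (Finset.sum_le_sum fun h _ => ?_)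
    rw [abs_of_nonneg (hS.cost_nonneg h _ _ (hS.state_mem hπ y h) _ (hS.action_mem hπ y h))]
    exact hS.cost_le h _ _ (hS.state_mem hπ y h) _ (hS.action_mem hπ y h)
  have hdev : Integrable (fun y => ∑ h ∈ Finset.range S.horizon,
        max (‖S.action π y h - S.action prior y h‖ - (Real.sqrt (1 + lam) - 1) ^ 2
          * S.gainG σx σu β A C₂ h * S.roundRisk prior y h) 0) μ := by
    refine integrable_of_measurable_of_abs_le (Finset.measurable_fun_sum _ fun h _ => ?_)
      (C := ∑ _h ∈ Finset.range S.horizon, A) fun y => ?_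
    · have h1 := hS.measurable_action hπ h
      have h2 := hS.measurable_action hT.prior_admissible h
      have h3 := hS.measurable_roundRisk hT.prior_admissible h
      fun_prop
    · refine (Finset.abs_sum_le_sum_abs _ _).trans (Finset.sum_le_sum fun h _ => ?_)
      rw [abs_of_nonneg (le_max_right _ _)]
      refine max_le ?_ hS.A_nonneg
      have h1 := hS.action_size _ (hS.action_mem hπ y h) _
        (hS.action_mem hT.prior_admissible y h)
      have h2 : 0 ≤ S.gainG σx σu β A C₂ h := by
        have h3 : 0 ≤ β * A * S.gainFactor σx σu C₂ h :=
          mul_nonneg (mul_nonneg hS.β_pos.le hS.A_nonneg) (hT.gainFactor_pos h).le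
        exact div_nonneg zero_le_two h3
      have h4 : 0 ≤ S.roundRisk prior y h := hS.risk_nonneg _ _ _ _
      have h5 : 0 ≤ (Real.sqrt (1 + lam) - 1) ^ 2 * S.gainG σx σu β A C₂ h
        * S.roundRisk prior y h := by positivity
      linarith
  rw [← integral_const_mul, ← integral_add hloss (hdev.const_mul _)]
  exact integral_mono hsafe (hloss.add (hdev.const_mul _)) fun y => hT.safeLoss_le hπ hL0 hL

/-! ### Empirical covers -/

theorem norm_le_sum_abs (v : Euc d) : ‖v‖ ≤ ∑ j, |v j| := by
  rw [EuclideanSpace.norm_eq]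
  refine Real.sqrt_le_left (Finset.sum_nonneg fun _ _ => abs_nonneg _) |>.2 ?_
  simpa using Finset.sum_sq_le_sq_sum_of_nonneg (s := Finset.univ) (f := fun j => |v j|)
    fun j _ => abs_nonneg _

/-- Finite empirical covers exist, so the covering number is attained. -/
theorem SafeSetup.exists_cover (hT : SafeSetup S σx σu α β Lc P A lam C₂ q m prior)
    {Pol : Set (Policy Y k d)} (hPol : ∀ π ∈ Pol, S.Admissible π) {n : ℕ} (D : Fin n → ℕ → Y)
    {ε : ℝ} (hε : 0 < ε) :
    ∃ T : Finset (Fin n → ℕ → Euc d), T.card = S.coveringNumber lam q m prior Pol D ε ∧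
      ∀ π ∈ Pol, ∃ b ∈ T, S.empDist (fun t h => S.safeAction lam q m prior π (D t) h) b ≤ ε := by
  classical
  refine Nat.sInf_mem (s := {N : ℕ | ∃ T : Finset (Fin n → ℕ → Euc d), T.card = N ∧
    ∀ π ∈ Pol, ∃ b ∈ T, S.empDist (fun t h => S.safeAction lam q m prior π (D t) h) b ≤ ε}) ?_
  set a : Policy Y k d → Fin n → Fin S.horizon → Euc d :=
    fun π t h => S.safeAction lam q m prior π (D t) h with ha
  have hbdd : Bornology.IsBounded (a '' Pol) := by
    refine Metric.isBounded_iff.2 ⟨A, ?_⟩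
    rintro _ ⟨π, hπ, rfl⟩ _ ⟨π', hπ', rfl⟩
    refine (dist_pi_le_iff hT.regular.A_nonneg).2 fun t =>
      (dist_pi_le_iff hT.regular.A_nonneg).2 fun h => ?_
    rw [dist_eq_norm]
    exact hT.regular.action_size _ (hT.safeAction_mem (hPol π hπ) h.2) _
      (hT.safeAction_mem (hPol π' hπ') h.2)
  have htb : TotallyBounded (a '' Pol) :=
    hbdd.isCompact_closure.totallyBounded.subset subset_closure
  obtain ⟨t, htf, ht⟩ := Metric.totallyBounded_iff.1 htb (ε / (S.horizon * d + 1)) (by positivity)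
  refine ⟨_, htf.toFinset.image fun c t h => if hh : h < S.horizon then c t ⟨h, hh⟩ else 0,
    rfl, fun π hπ => ?_⟩
  obtain ⟨c, hc, hc'⟩ := Set.mem_iUnion₂.1 (ht (Set.mem_image_of_mem a hπ))
  refine ⟨_, Finset.mem_image_of_mem _ (htf.mem_toFinset.2 hc), ?_⟩
  have hcoord : ∀ s : Fin n, ∀ h (hh : h < S.horizon), ∀ j,
      |S.safeAction lam q m prior π (D s) h j - c s ⟨h, hh⟩ j| ≤ ε / (S.horizon * d + 1) := by
    intro s h hh j
    have h1 : dist (a π s ⟨h, hh⟩) (c s ⟨h, hh⟩) ≤ ε / (S.horizon * d + 1) :=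
      ((dist_le_pi_dist _ _ _).trans (dist_le_pi_dist _ _ _)).trans (Metric.mem_ball.1 hc').le
    rw [dist_eq_norm] at h1
    exact (PiLp.norm_apply_le (a π s ⟨h, hh⟩ - c s ⟨h, hh⟩) j).trans h1
  have hinner : ∀ s : Fin n, ∑ h ∈ Finset.range S.horizon, ∑ j,
      |S.safeAction lam q m prior π (D s) h j
        - (if hh : h < S.horizon then c s ⟨h, hh⟩ else 0) j| ≤ ε := by
    intro s
    calc _ ≤ ∑ h ∈ Finset.range S.horizon, ∑ _j : Fin d, ε / (S.horizon * d + 1) := by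
          refine Finset.sum_le_sum fun h hh => Finset.sum_le_sum fun j _ => ?_
          rw [dif_pos (Finset.mem_range.1 hh)]
          exact hcoord s h (Finset.mem_range.1 hh) j
      _ = (S.horizon * d) * (ε / (S.horizon * d + 1)) := by
          simp only [Finset.sum_const, Finset.card_univ, Fintype.card_fin, Finset.card_range,
            nsmul_eq_mul]
          ring
      _ ≤ ε := by
          rw [mul_div_assoc', div_le_iff₀ (by positivity)]
          nlinarith
  have hsum := Finset.sum_le_card_nsmul (Finset.univ : Finset (Fin n)) _ _ fun s _ => hinner s
  rw [Finset.card_univ, Fintype.card_fin, nsmul_eq_mul] at hsum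
  unfold empDist
  rcases Nat.eq_zero_or_pos n with rfl | hn
  · simp [hε.le]
  · have hn' : (0 : ℝ) < n := by exact_mod_cast hn
    rw [one_div, inv_mul_le_iff₀ hn']
    exact hsum

/-- A cover of the safe actions turns into a cover of the losses by members of the class; replacing
the centers by members of the class doubles the radius. -/
theorem SafeSetup.exists_loss_cover (hT : SafeSetup S σx σu α β Lc P A lam C₂ q m prior)
    {Pol : Set (Policy Y k d)} (hPol : ∀ π ∈ Pol, S.Admissible π) {n : ℕ} (hn : 0 < n)
    (D : Fin n → ℕ → Y) {ε : ℝ} (hε : 0 < ε) :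
    ∃ T : Finset Pol, T.card ≤ S.coveringNumber lam q m prior Pol D ε ∧
      ∀ π : Pol, ∃ π' ∈ T, ∑ t, |S.safeLoss lam q m prior π (D t)
        - S.safeLoss lam q m prior π' (D t)| ≤ n * (S.constK σx σu Lc * (2 * ε)) := by
  classical
  obtain ⟨T, hTcard, hTcov⟩ := hT.exists_cover hPol D hε
  rcases isEmpty_or_nonempty Pol with hemp | ⟨⟨π₀⟩⟩
  · exact ⟨∅, by simp, fun π => (hemp.false π).elim⟩
  set a : Policy Y k d → Fin n → ℕ → Euc d := fun π t h => S.safeAction lam q m prior π (D t) h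
    with ha
  have hrep : ∀ b : Fin n → ℕ → Euc d, ∃ π' : Pol,
      (∃ π : Pol, S.empDist (a π) b ≤ ε) → S.empDist (a π') b ≤ ε := by
    intro b
    by_cases hb : ∃ π : Pol, S.empDist (a π) b ≤ ε
    · obtain ⟨π, hπ⟩ := hb
      exact ⟨π, fun _ => hπ⟩
    · exact ⟨π₀, fun h => (hb h).elim⟩
  choose rep hrep using hrep
  refine ⟨T.image rep, Finset.card_image_le.trans hTcard.le, fun π => ?_⟩
  obtain ⟨b, hb, hπb⟩ := hTcov π π.2
  refine ⟨rep b, Finset.mem_image_of_mem _ hb, ?_⟩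
  have hrepb := hrep b ⟨π, hπb⟩
  have hn' : (0 : ℝ) < n := by exact_mod_cast hn
  have hK : 0 ≤ S.constK σx σu Lc := by
    have := hT.regular.σx_nonneg
    have := hT.regular.σu_nonneg
    have := hT.regular.Lc_nonneg
    unfold constK
    positivity
  have hunfold : ∀ c c' : Fin n → ℕ → Euc d, S.empDist c c' ≤ ε →
      ∑ t, ∑ h ∈ Finset.range S.horizon, ∑ j, |c t h j - c' t h j| ≤ n * ε := by
    intro c c' h
    rwa [empDist, one_div, inv_mul_le_iff₀ hn'] at h
  have h1 := hunfold _ _ hπb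
  have h2 := hunfold _ _ hrepb
  calc ∑ t, |S.safeLoss lam q m prior π (D t) - S.safeLoss lam q m prior (rep b) (D t)|
      ≤ ∑ t, S.constK σx σu Lc *
          ∑ h ∈ Finset.range S.horizon, ‖a π t h - a (rep b) t h‖ :=
        Finset.sum_le_sum fun t _ =>
          hT.abs_safeLoss_sub_le (hPol π π.2) (hPol (rep b) (rep b).2)
    _ ≤ ∑ t, S.constK σx σu Lc * ∑ h ∈ Finset.range S.horizon,
          (∑ j, |a π t h j - b t h j| + ∑ j, |a (rep b) t h j - b t h j|) := by
        gcongr with t _ h _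
        refine (norm_le_sum_abs _).trans ?_
        rw [← Finset.sum_add_distrib]
        refine Finset.sum_le_sum fun j _ => ?_
        rw [abs_sub_comm (a (rep b) t h j)]
        exact abs_sub_le _ _ _
    _ = S.constK σx σu Lc * (∑ t, ∑ h ∈ Finset.range S.horizon, ∑ j, |a π t h j - b t h j|
          + ∑ t, ∑ h ∈ Finset.range S.horizon, ∑ j, |a (rep b) t h j - b t h j|) := by
        simp only [← Finset.mul_sum, Finset.sum_add_distrib]
    _ ≤ S.constK σx σu Lc * (n * ε + n * ε) := by gcongr
    _ = n * (S.constK σx σu Lc * (2 * ε)) := by ring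

end Setup

end ControlSystem

/-! ### The regret of safety-aware finetuning -/

theorem mainTheorem4 :
    ∃ C : ℝ, 0 < C ∧
      ∀ (Y : Type*) [MeasurableSpace Y] (k d : ℕ) (S : ControlSystem Y k d)
        (σx σu α β Lc P A : ℝ) (_ : S.Regular σx σu α β Lc P A)
        -- the safety level, the constant of the reservation, the reservation weights
        (lam C₂ : ℝ) (_ : 0 < lam) (_ : 1 < C₂)
        (q : ℕ → ℝ)
        (_ : q = S.reservationWeight (1 + 1 / Real.sqrt (1 + lam)) C₂ lam β σx)
        -- the map to the safe action set
        (m : (Euc d → ℝ) → Euc d → Euc d → Euc d)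
        (_ : S.IsProjectionMap m ∨ S.IsCombinationMap m)
        -- the control prior and the class of ML policies
        (prior : Policy Y k d) (_ : S.Admissible prior)
        (Pol : Set (Policy Y k d)) (_ : ∀ π ∈ Pol, S.Admissible π)
        (_ : S.PointwiseMeasurable lam q m prior Pol)
        -- the unconstrained comparator
        (πstar : Policy Y k d) (_ : πstar ∈ Pol)
        (Lπ : ℝ) (_ : 0 ≤ Lπ) (_ : S.PolicyLipschitz πstar Lπ)
        -- the distribution of a context sequence, the sample size, the levels
        (μ : Measure (ℕ → Y)) [IsProbabilityMeasure μ]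
        (n : ℕ) (_ : 0 < n) (δ ε : ℝ) (_ : 0 < δ) (_ : δ < 1) (_ : 0 < ε),
        (Measure.pi (fun _ : Fin n => μ))
          {D | ¬ ∀ πn : Policy Y k d, S.IsFinetuned lam q m prior Pol D πn →
            ∫ y, S.safeLoss lam q m prior πn y ∂μ ≤
              ∫ y, S.loss πstar y ∂μ
              + S.constB σx σu Lc Lπ *
                  ∫ y, ∑ h ∈ Finset.range S.horizon,
                    max (‖S.action πstar y h - S.action prior y h‖
                      - (Real.sqrt (1 + lam) - 1) ^ 2 * S.gainG σx σu β A C₂ h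
                          * S.roundRisk prior y h) 0 ∂μ
              + C * (S.horizon * P * Real.sqrt (1 / (n : ℝ) *
                      Real.log (S.coveringNumber lam q m prior Pol D ε / δ))
                    + S.constK σx σu Lc * ε)}
          ≤ ENNReal.ofReal δ := by
  refine ⟨12, by norm_num, ?_⟩
  intro Y _ k d S σx σu α β Lc P A hS lam C₂ hlam hC₂ q hq m hm prior hprior Pol hPol hmeas πstar
    hstar Lπ hLπ hLip μ _ n hn δ ε hδ hδ1 hε
  have hT : S.SafeSetup σx σu α β Lc P A lam C₂ q m prior := ⟨hS, hlam, hC₂, hq, hm, hprior⟩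
  obtain ⟨hact, Pol₀, hsub, hcount, hdense⟩ := hmeas
  have hne : Pol₀.Nonempty := by
    obtain ⟨p, hp, -⟩ := hdense πstar hstar
    exact ⟨p 0, hp 0⟩
  obtain ⟨e, he⟩ := hcount.exists_eq_range hne
  have heP : ∀ j, e j ∈ Pol := fun j => hsub (he ▸ Set.mem_range_self j)
  have hK : 0 ≤ S.constK σx σu Lc := by
    have := hS.σx_nonneg
    have := hS.σu_nonneg
    have := hS.Lc_nonneg
    unfold ControlSystem.constK
    positivity
  have hcomp := hT.integral_safeLoss_le (hPol _ hstar) (hact _ hstar) hLπ hLip μ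
  have hstat := measure_empirical_minimizer_bad_le (μ := μ) (I := Pol)
    (ℓ := fun π y => S.safeLoss lam q m prior π y) (M := S.horizon * P)
    (fun π => hS.measurable_safeLoss (hact π π.2))
    (fun π y => ⟨hT.safeLoss_nonneg (hPol π π.2), hT.safeLoss_le_horizon_mul (hPol π π.2)⟩)
    ⟨πstar, hstar⟩ (e := fun j => ⟨e j, heP j⟩)
    (fun π => by
      obtain ⟨p, hp, hlim⟩ := hdense π π.2
      have hidx : ∀ i, ∃ j, e j = p i := fun i => by
        have := hp i
        rwa [he] at this
      choose idx hidx using hidx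
      refine ⟨idx, fun y => ?_⟩
      simp only [hidx]
      exact hT.tendsto_safeLoss (hPol π π.2) (fun i => hPol _ (hsub (hp i))) (hlim y))
    hn (η := S.constK σx σu Lc * (2 * ε)) (by positivity)
    (N := fun D => S.coveringNumber lam q m prior Pol D ε)
    (fun D => hT.exists_loss_cover hPol hn D hε) hδ hδ1
  refine (measure_mono fun D hD => ?_).trans hstat
  simp only [Set.mem_ofPred_eq, not_forall, not_le] at hD
  obtain ⟨πn, ⟨hπn, hmin⟩, hbad⟩ := hD
  refine ⟨⟨πn, hπn⟩, fun π => hmin π π.2, ?_⟩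
  have hKε : 0 ≤ S.constK σx σu Lc * ε := by positivity
  simp only
  linarith
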